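/- Let $\mathbb C_+=\{s\in\mathbb C:\operatorname{Re}s>0\}$. Let $a>0$ and $b\in\mathbb R$ be such that $\beta:=b+\frac{1-a}{2}>0$, i.e. such that the affine map $\phi(s)=as+\beta$, which is determined by $\phi(n+\tfrac12)=p_n+\tfrac12$ for $p_n:=an+b$, has positive constant term (then $p_n>-\tfrac12$ for all $n\ge 0$). Let $(c_n)_{n\ge 0}$ be complex numbers, and consider the affine-index monomial operator $T$ given by $T(x^n)=c_nx^{p_n}$, $n=0,1,2,\dots$. We call $T$ bounded if it extends to a bounded linear operator on the complex space $L^2(0,1)$. An associated interpolating function of $T$ is a function $h$ in the Smirnov class of $\mathbb C_+$ with $h(n+\tfrac12)=\overline{c_n}$ for all $n\ge 0$. Here the Smirnov class consists of the holomorphic $h:\mathbb C_+\to\mathbb C$ for which there is $u:\mathbb R\to[0,\infty)$ with $\int_{\mathbb R}\frac{u(t)}{1+t^2}\,dt<\infty$ and $$\log^+|h(x+iy)|\le\frac1\pi\int_{\mathbb R}\frac{x\,u(t)}{x^2+(y-t)^2}\,dt\qquad(x>0,\ y\in\mathbb R).$$ Then: 1. there is at most one associated interpolating function $h$; 2. if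 $T$ is bounded, then the associated interpolating function exists; 3. if the associated interpolating function $h$ exists, then $T$ is bounded if and only if $h$ is uniformly locally square-integrable on the imaginary axis, i.e. the limit $h(iy)=\lim_{x\to0+}h(x+iy)$ exists for almost every $y\in\mathbb R$ and $$\sup_{t\in\mathbb R}\int_t^{t+1}|h(iy)|^2\,dy<\infty .$$ -/

import Mathlib

open MeasureTheory Filter Topology

noncomputable section

namespace MonomialOp

/-- The complex Hilbert space `L²(0,1)`. -/
abbrev L2 : Type := Lp ℂ 2 (volume.restrict (Set.Ioo (0 : ℝ) 1))

theorem memLp_cpow {p : ℂ} (hp : -1 / 2 < p.re) :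
    MemLp (fun x : ℝ => (x : ℂ) ^ p) 2 (volume.restrict (Set.Ioo (0 : ℝ) 1)) := by
  have hmeas : AEStronglyMeasurable (fun x : ℝ => (x : ℂ) ^ p)
      (volume.restrict (Set.Ioo (0 : ℝ) 1)) := by
    apply Measurable.aestronglyMeasurable
    exact Complex.measurable_ofReal.pow_const p
  rw [memLp_two_iff_integrable_sq_norm hmeas]
  have h1 : IntegrableOn (fun x : ℝ => x ^ (2 * p.re)) (Set.Ioo (0 : ℝ) 1) := by
    rw [intervalIntegral.integrableOn_Ioo_rpow_iff one_pos]
    linarith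
  refine h1.congr_fun (fun x hx => ?_) measurableSet_Ioo
  simp only
  rw [Complex.norm_cpow_eq_rpow_re_of_pos hx.1, ← Real.rpow_natCast, ← Real.rpow_mul hx.1.le]
  congr 1
  push_cast
  ring

/-- The function `x ↦ x ^ p`, as an element of `L²(0,1)`, for `Re p > -1/2`. -/
def monomial (p : ℂ) (hp : -1 / 2 < p.re) : L2 := (memLp_cpow hp).toLp _

theorem natCast_re (n : ℕ) : -1 / 2 < (n : ℂ).re := by
  rw [Complex.natCast_re]
  have : (0 : ℝ) ≤ n := n.cast_nonneg
  linarith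

/-- The assignment `x ^ n ↦ c n * x ^ (p n)`, `n = 0, 1, 2, …`, comes from a bounded linear
operator on `L²(0,1)`. -/
def IsBounded (c p : ℕ → ℂ) (hp : ∀ n, -1 / 2 < (p n).re) : Prop :=
  ∃ T : L2 →L[ℂ] L2, ∀ n : ℕ, T (monomial n (natCast_re n)) = c n • monomial (p n) (hp n)

/-- The Poisson integral of `u` at the point `x + i y` of the right half-plane. -/
def poissonIntegral (u : ℝ → ℝ) (x y : ℝ) : ℝ :=
  ∫ t : ℝ, Real.pi⁻¹ * (x / (x ^ 2 + (y - t) ^ 2)) * u t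

/-- The Smirnov class of the right half-plane: holomorphic functions `h` such that `log⁺ |h|` is
dominated by the Poisson integral of a nonnegative function `u` with
`∫ u(t) / (1 + t ^ 2) dt < ∞` (that is, it has a quasi-bounded harmonic majorant). -/
def IsSmirnov (h : ℂ → ℂ) : Prop :=
  DifferentiableOn ℂ h {s : ℂ | 0 < s.re} ∧
    ∃ u : ℝ → ℝ, (∀ t, 0 ≤ u t) ∧ Integrable (fun t : ℝ => u t / (1 + t ^ 2)) ∧
      ∀ x y : ℝ, 0 < x → Real.posLog ‖h (x + y * Complex.I)‖ ≤ poissonIntegral u x y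

/-- `h` is an interpolating function associated with the coefficients `c`: it is in the Smirnov
class of the right half-plane, and `h (n + 1/2)` is the conjugate of `c n` for all `n`. Only the
values of `h` on the open right half-plane matter. -/
structure IsAssociated (c : ℕ → ℂ) (h : ℂ → ℂ) : Prop where
  smirnov : IsSmirnov h
  interp : ∀ n : ℕ, h (n + 1 / 2) = starRingEnd ℂ (c n)

/-- `g` is the boundary function `y ↦ h (i y)` of `h` on the imaginary axis, defined almost
everywhere by `h (i y) = lim_{x → 0+} h (x + i y)`. -/
def IsBoundaryFunction (h : ℂ → ℂ) (g : ℝ → ℂ) : Prop :=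
  ∀ᵐ y : ℝ, Tendsto (fun x : ℝ => h (x + y * Complex.I)) (𝓝[>] 0) (𝓝 (g y))

/-- `sup_t ∫_t^{t+1} |h (i y)|² dy < ∞`, for the boundary function of `h`. -/
def UniformlyLocallyL2 (h : ℂ → ℂ) : Prop :=
  ∃ g : ℝ → ℂ, IsBoundaryFunction h g ∧
    (⨆ t : ℝ, ∫⁻ y in Set.Icc t (t + 1), ‖g y‖ₑ ^ 2) < ⊤

end MonomialOp

end

noncomputable section

namespace MonomialOp

open FourierTransform
open scoped ENNReal

/-! The Mellin transform `mell f s = ∫ x^(s-1/2) f(x) dx` carries L²(0,1) into the Hardy space H² of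
the right half-plane, isometrically up to the factor √(2π) on boundary values (`lintegral_bdry_sq`).
Monomials become reproducing kernels: `⟨x^p, f⟩ = mell f (p̄ + 1/2)` and `mell (x^p) s = 1/(s + p +
1/2)` (`inner_monomial`, `mell_monomial`). Hence, when T is bounded, `mell (T* f) (n + 1/2) = c̄_n ·
mell f (φ(n + 1/2))`: on the Mellin side T* interpolates the weighted composition operator F ↦ h ·
(F ∘ φ).

Uniqueness. Multiplying by outer functions makes a difference of Smirnov functions bounded
(`IsSmirnov.exists_outer`). The points n + 1/2 violate the Blaschke condition because the harmonic
series diverges, so a bounded function vanishing there is zero (`eq_zero_of_bounded_of_zeros`).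

Existence and necessity. Applying T* to x^q and dividing out the kernel gives h(s) = mell(T* x^q)(s)
· (φ(s) + q + 1/2) (`isAssociated_adjoint`). By uniqueness every q produces the same h. On the
window [τ, τ+1] of the imaginary axis take q = -iaτ: then ‖x^q‖ = 1 and the affine factor is bounded
independently of τ, so the local L² norm of h is controlled by ‖T*‖.

Sufficiency. The line φ(iℝ) lies at distance β > 0 inside the half-plane, where a local Sobolev
inequality makes |h(iy)|² dy a Carleson-type weight (`exists_lintegral_mul_mell_sq_le`). Cauchy's
formula on Re s = ε, for h damped by outer functions, bounds the form ⟨T P, Q⟩ on polynomials by a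
boundary integral (`enorm_sum_le_lintegral`). Cauchy–Schwarz and density of the polynomials finish
the proof. Boundary values throughout come from the Poisson representation of `mell f` and a Fatou
theorem (`ae_tendsto_poisson`). -/

/-! ### Plancherel and Parseval on L¹ ∩ L². -/

theorem fourier_toLp_ae_eq {f : ℝ → ℂ} (h1 : Integrable f) (h2 : MemLp f 2) :
    ((𝓕 (h2.toLp f) : Lp ℂ 2 (volume : Measure ℝ)) : ℝ → ℂ) =ᵐ[volume] 𝓕 f := by
  have hc : Continuous (𝓕 f) :=
    VectorFourier.fourierIntegral_continuous Real.continuous_fourierChar continuous_inner h1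
  -- Testing against smooth compactly supported `g` suffices. The L² transform is unfolded through
  -- tempered distributions, the pointwise one through the multiplication formula ∫ ĝ f = ∫ g f̂.
  refine ae_eq_of_integral_contDiff_smul_eq
    ((Lp.memLp _).locallyIntegrable (by norm_num)) hc.locallyIntegrable ?_
  intro g hg hgs
  have hg' : HasCompactSupport (fun x => (g x : ℂ)) := hgs.comp_left (g := Complex.ofReal) (by simp)
  let G : SchwartzMap ℝ ℂ := hg'.toSchwartzMap (Complex.ofRealCLM.contDiff.comp hg)
  have e1 := congrArg (fun F => F G)
    (Lp.fourier_toTemperedDistribution_eq (E := ℝ) (F := ℂ) (h2.toLp f))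
  simp only [TemperedDistribution.fourier_apply, Lp.toTemperedDistribution_apply] at e1
  have e2 := VectorFourier.integral_fourierIntegral_smul_eq_flip (L := innerₗ ℝ) (μ := volume)
    (ν := volume) (f := G) (g := f) Real.continuous_fourierChar continuous_inner
    G.integrable h1
  have e3 : ∫ x, (𝓕 G : SchwartzMap ℝ ℂ) x • (h2.toLp f) x
      = ∫ ξ, VectorFourier.fourierIntegral Real.fourierChar volume (innerₗ ℝ) G ξ • f ξ := by
    refine integral_congr_ae ?_
    filter_upwards [h2.coeFn_toLp] with x hx
    rw [hx, SchwartzMap.fourier_coe]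
    rfl
  have e4 : ∫ x, G x • VectorFourier.fourierIntegral Real.fourierChar volume
      (innerₗ ℝ).flip f x = ∫ x, g x • 𝓕 f x := by
    rw [flip_innerₗ]
    rfl
  rw [← e4, ← e2, ← e3, e1]
  rfl

theorem lintegral_enorm_sq_eq {f : ℝ → ℂ} {μ : Measure ℝ} :
    ∫⁻ x, ‖f x‖ₑ ^ 2 ∂μ = eLpNorm f 2 μ ^ 2 := by
  have := eLpNorm_nnreal_pow_eq_lintegral (f := f) (μ := μ) (p := 2) (by norm_num)
  simp only [NNReal.coe_ofNat, ENNReal.coe_ofNat] at this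
  norm_cast at this
  rw [← this]

theorem lintegral_enorm_sq_lp {μ : Measure ℝ} (f : Lp ℂ 2 μ) :
    ∫⁻ x, ‖f x‖ₑ ^ 2 ∂μ = ‖f‖ₑ ^ 2 := by
  rw [lintegral_enorm_sq_eq, Lp.enorm_def]

/-- Plancherel's theorem for integrable square-integrable functions. -/
theorem lintegral_fourier_sq {f : ℝ → ℂ} (h1 : Integrable f) (h2 : MemLp f 2) :
    ∫⁻ w, ‖𝓕 f w‖ₑ ^ 2 = ∫⁻ t, ‖f t‖ₑ ^ 2 := by
  have e1 : ∫⁻ w, ‖𝓕 f w‖ₑ ^ 2 = ‖𝓕 (h2.toLp f)‖ₑ ^ 2 := by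
    rw [← lintegral_enorm_sq_lp]
    refine lintegral_congr_ae ?_
    filter_upwards [fourier_toLp_ae_eq h1 h2] with x hx
    rw [hx]
  have e2 : ∫⁻ w, ‖f w‖ₑ ^ 2 = ‖(h2.toLp f)‖ₑ ^ 2 := by
    rw [← lintegral_enorm_sq_lp]
    refine lintegral_congr_ae ?_
    filter_upwards [h2.coeFn_toLp] with x hx
    rw [hx]
  rw [e1, e2, ← ofReal_norm, ← ofReal_norm, Lp.norm_fourier_eq]

/-- Parseval in an asymmetric form: `k` will be an explicit kernel whose transform is known
pointwise, while `f` is only square-integrable and keeps its abstract L² transform. -/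
theorem integral_conj_mul_fourier {k f : ℝ → ℂ} (h1 : Integrable k) (h2 : MemLp k 2)
    (hf : MemLp f 2) :
    ∫ t, starRingEnd ℂ (k t) * f t
      = ∫ w, starRingEnd ℂ (𝓕 k w) * (𝓕 (hf.toLp f) : Lp ℂ 2 (volume : Measure ℝ)) w := by
  have := Lp.inner_fourier_eq (h2.toLp k) (hf.toLp f)
  rw [L2.inner_def, L2.inner_def] at this
  have e1 : ∫ t, starRingEnd ℂ (k t) * f t
      = ∫ a, inner ℂ ((h2.toLp k) a) ((hf.toLp f) a) := by
    refine integral_congr_ae ?_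
    filter_upwards [h2.coeFn_toLp, hf.coeFn_toLp] with x hx hy
    rw [hx, hy, RCLike.inner_apply, mul_comm]
  rw [e1, ← this]
  refine integral_congr_ae ?_
  filter_upwards [fourier_toLp_ae_eq h1 h2] with x hx
  rw [hx, RCLike.inner_apply, mul_comm]

/-! ### The Mellin transform on `L²(0,1)` -/

/-- `∫_0^1 x ^ (s - 1/2) f(x) dx`. -/
def mell (f : ℝ → ℂ) (s : ℂ) : ℂ := ∫ x in Set.Ioo (0 : ℝ) 1, (x : ℂ) ^ (s - 1 / 2) * f x

/-- The function `u ↦ e^{-u/2} f(e^{-u})` on `(0, ∞)`, extended by zero. -/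
def lift (f : ℝ → ℂ) (u : ℝ) : ℂ :=
  Real.exp (-u / 2) * (Set.Ioo (0 : ℝ) 1).indicator f (Real.exp (-u))

theorem mell_eq_mellin (f : ℝ → ℂ) (s : ℂ) :
    mell f s = mellin ((Set.Ioo (0 : ℝ) 1).indicator f) (s + 1 / 2) := by
  rw [mell, mellin, ← integral_indicator measurableSet_Ioo, ← integral_indicator measurableSet_Ioi]
  congr 1
  ext x
  by_cases hx : x ∈ Set.Ioo (0 : ℝ) 1
  · have : x ∈ Set.Ioi (0 : ℝ) := hx.1
    rw [Set.indicator_of_mem hx, Set.indicator_of_mem this, Set.indicator_of_mem hx, smul_eq_mul]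
    congr 2
    ring
  · rw [Set.indicator_of_notMem hx]
    simp [Set.indicator, hx]

/-- The substitution x = e^(-u) turns the Mellin transform on a vertical line into a Fourier
transform; the factor e^(-u/2) in `lift` is the square root of the Jacobian and makes `lift`
isometric. -/
theorem mell_eq_fourier (f : ℝ → ℂ) (x y : ℝ) :
    mell f (x + y * Complex.I)
      = 𝓕 (fun u : ℝ => (Real.exp (-x * u) : ℂ) * lift f u) (y / (2 * Real.pi)) := by
  have h1 : ∀ u : ℝ, (Real.exp (-x * u) : ℂ) * lift f u
      = Real.exp (-(x + y * Complex.I + 1 / 2 : ℂ).re * u) •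
        (Set.Ioo (0 : ℝ) 1).indicator f (Real.exp (-u)) := by
    intro u
    rw [lift, Complex.real_smul, ← mul_assoc, ← Complex.ofReal_mul, ← Real.exp_add]
    congr 3
    simp
    ring
  have h2 : (x + y * Complex.I + 1 / 2 : ℂ).im = y := by simp
  rw [mell_eq_mellin, mellin_eq_fourier, h2]
  simp_rw [h1]

theorem lift_of_nonpos (f : ℝ → ℂ) {u : ℝ} (hu : u ≤ 0) : lift f u = 0 := by
  have : Real.exp (-u) ∉ Set.Ioo (0 : ℝ) 1 := by
    intro h
    have := Real.one_le_exp (x := -u) (by linarith)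
    linarith [h.2]
  simp [lift, this]

theorem lintegral_comp_exp_neg (F : ℝ → ℝ≥0∞) :
    ∫⁻ u, ENNReal.ofReal (Real.exp (-u)) * F (Real.exp (-u)) = ∫⁻ x in Set.Ioi 0, F x := by
  have him : (fun u : ℝ => Real.exp (-u)) '' Set.univ = Set.Ioi 0 := by
    ext x
    simp only [Set.image_univ, Set.mem_range, Set.mem_Ioi]
    exact ⟨fun ⟨u, hu⟩ => hu ▸ Real.exp_pos _, fun hx => ⟨-Real.log x, by simp [Real.exp_log hx]⟩⟩
  rw [← him, lintegral_image_eq_lintegral_abs_deriv_mul MeasurableSet.univ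
    (f' := fun u => -Real.exp (-u))]
  · simp
  · intro u _
    simpa using (hasDerivAt_neg u).exp.hasDerivWithinAt (s := Set.univ)
  · intro a _ b _ h
    simpa using h

theorem lintegral_lift_sq (f : ℝ → ℂ) :
    ∫⁻ u, ‖lift f u‖ₑ ^ 2 = ∫⁻ x in Set.Ioo (0 : ℝ) 1, ‖f x‖ₑ ^ 2 := by
  have h1 : ∀ u, ‖lift f u‖ₑ ^ 2 = ENNReal.ofReal (Real.exp (-u)) *
      (Set.Ioo (0 : ℝ) 1).indicator (fun x => ‖f x‖ₑ ^ 2) (Real.exp (-u)) := by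
    intro u
    rw [lift, enorm_mul, mul_pow]
    congr 1
    · rw [← ofReal_norm, ← ENNReal.ofReal_pow (norm_nonneg _), Complex.norm_real,
        Real.norm_of_nonneg (Real.exp_pos _).le, ← Real.exp_nat_mul]
      congr 2
      push_cast
      ring
    · simp only [Set.indicator]
      split_ifs <;> simp
  simp_rw [h1]
  rw [lintegral_comp_exp_neg, ← lintegral_indicator measurableSet_Ioi,
    ← lintegral_indicator measurableSet_Ioo]
  congr 1
  ext x
  by_cases hx : x ∈ Set.Ioo (0 : ℝ) 1
  · have : x ∈ Set.Ioi (0 : ℝ) := hx.1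
    rw [Set.indicator_of_mem this]
  · simp [Set.indicator, hx]

theorem memLp_two_iff {f : ℝ → ℂ} {μ : Measure ℝ} (hf : AEStronglyMeasurable f μ) :
    MemLp f 2 μ ↔ ∫⁻ x, ‖f x‖ₑ ^ 2 ∂μ < ⊤ := by
  rw [lintegral_enorm_sq_eq, MemLp, ENNReal.pow_lt_top_iff]
  simp [hf]

theorem memLp_lift (f : L2) : MemLp (lift f) 2 := by
  have hm : Measurable (lift f) := by
    have : Measurable ((Set.Ioo (0 : ℝ) 1).indicator f) :=
      (Lp.stronglyMeasurable f).measurable.indicator measurableSet_Ioo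
    unfold lift
    fun_prop
  rw [memLp_two_iff hm.aestronglyMeasurable, lintegral_lift_sq, lintegral_enorm_sq_lp]
  simp [ENNReal.pow_lt_top_iff]

theorem lintegral_lift_lp (f : L2) : ∫⁻ u, ‖lift f u‖ₑ ^ 2 = ‖f‖ₑ ^ 2 := by
  rw [lintegral_lift_sq, lintegral_enorm_sq_lp]

/-! ### Poisson representation of Mellin transforms. -/

theorem integrable_exp_neg_mul_abs {c : ℝ} (hc : 0 < c) :
    Integrable (fun u : ℝ => Real.exp (-c * |u|)) := by
  have h1 : IntegrableOn (fun u : ℝ => Real.exp (-c * |u|)) (Set.Ioi 0) := by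
    refine (integrableOn_exp_mul_Ioi (neg_neg_of_pos hc) 0).congr_fun (fun u hu => ?_)
      measurableSet_Ioi
    simp only [abs_of_pos (Set.mem_Ioi.1 hu)]
  have h2 : IntegrableOn (fun u : ℝ => Real.exp (-c * |u|)) (Set.Iic 0) := by
    refine (integrableOn_exp_mul_Iic hc 0).congr_fun (fun u hu => ?_) measurableSet_Iic
    simp only [abs_of_nonpos (Set.mem_Iic.1 hu), mul_neg, neg_mul, neg_neg]
  rw [← integrableOn_univ, ← Set.Iic_union_Ioi (a := (0 : ℝ))]
  exact h2.union h1

theorem memLp_exp_neg_mul_abs {c : ℝ} (hc : 0 < c) :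
    MemLp (fun u : ℝ => Real.exp (-c * |u|)) 2 := by
  rw [memLp_two_iff_integrable_sq (by fun_prop : Continuous _).aestronglyMeasurable]
  refine (integrable_exp_neg_mul_abs (c := 2 * c) (by linarith)).congr (.of_forall fun u => ?_)
  simp only
  rw [← Real.exp_nat_mul]
  congr 1
  push_cast
  ring

/-- The function `u ↦ e^{-x|u| + iyu}`, whose Fourier transform is the Poisson kernel. -/
def poissonExp (x y u : ℝ) : ℂ := Complex.exp (-(x * |u| : ℝ) + (y * u : ℝ) * Complex.I)

theorem norm_poissonExp (x y u : ℝ) : ‖poissonExp x y u‖ = Real.exp (-x * |u|) := by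
  rw [poissonExp, Complex.norm_exp]
  congr 1
  simp

theorem continuous_poissonExp (x y : ℝ) : Continuous (poissonExp x y) := by
  unfold poissonExp
  fun_prop

theorem integrable_poissonExp {x : ℝ} (hx : 0 < x) (y : ℝ) : Integrable (poissonExp x y) :=
  (integrable_exp_neg_mul_abs hx).mono' (continuous_poissonExp x y).aestronglyMeasurable
    (.of_forall fun u => (norm_poissonExp x y u).le)

theorem memLp_poissonExp {x : ℝ} (hx : 0 < x) (y : ℝ) : MemLp (poissonExp x y) 2 :=
  (memLp_exp_neg_mul_abs hx).of_le (continuous_poissonExp x y).aestronglyMeasurable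
    (.of_forall fun u => by rw [norm_poissonExp, Real.norm_of_nonneg (Real.exp_pos _).le])

theorem integral_poissonExp {x : ℝ} (hx : 0 < x) (y : ℝ) :
    ∫ u, poissonExp x y u = ((2 * x / (x ^ 2 + y ^ 2) : ℝ) : ℂ) := by
  have hi := integrable_poissonExp hx y
  have h1 : ∫ u in Set.Iic 0, poissonExp x y u
      = ∫ u : ℝ in Set.Iic 0, Complex.exp ((x + y * Complex.I) * u) := by
    refine setIntegral_congr_fun measurableSet_Iic (fun u hu => ?_)
    simp only [poissonExp, abs_of_nonpos (Set.mem_Iic.1 hu)]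
    congr 1
    push_cast
    ring
  have h2 : ∫ u in Set.Ioi 0, poissonExp x y u
      = ∫ u : ℝ in Set.Ioi 0, Complex.exp ((-x + y * Complex.I) * u) := by
    refine setIntegral_congr_fun measurableSet_Ioi (fun u hu => ?_)
    simp only [poissonExp, abs_of_pos (Set.mem_Ioi.1 hu)]
    congr 1
    push_cast
    ring
  rw [← intervalIntegral.integral_Iic_add_Ioi hi.integrableOn hi.integrableOn, h1, h2,
    integral_exp_mul_complex_Iic (by simpa using hx), integral_exp_mul_complex_Ioi (by simpa using hx)]
  have n1 : (x + y * Complex.I : ℂ) ≠ 0 := fun h => hx.ne' (by simpa using congrArg Complex.re h)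
  have n2 : (-x + y * Complex.I : ℂ) ≠ 0 := fun h => hx.ne' (by simpa using congrArg Complex.re h)
  have n3 : (x ^ 2 + y ^ 2 : ℂ) ≠ 0 := by
    have : (0 : ℝ) < x ^ 2 + y ^ 2 := by positivity
    exact_mod_cast this.ne'
  simp only [Complex.ofReal_zero, mul_zero, Complex.exp_zero]
  push_cast
  field_simp
  ring_nf
  simp only [Complex.I_sq]
  ring

theorem fourier_poissonExp {x : ℝ} (hx : 0 < x) (y w : ℝ) :
    𝓕 (poissonExp x y) w = ((2 * x / (x ^ 2 + (y - 2 * Real.pi * w) ^ 2) : ℝ) : ℂ) := by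
  rw [← integral_poissonExp hx, Real.fourier_real_eq_integral_exp_smul]
  congr 1
  ext u
  rw [poissonExp, poissonExp, smul_eq_mul, ← Complex.exp_add]
  congr 1
  push_cast
  ring

theorem mell_eq_integral (f : ℝ → ℂ) (s : ℂ) :
    mell f s = ∫ u : ℝ, Complex.exp (-s * u) * lift f u := by
  conv_lhs => rw [← Complex.re_add_im s]
  rw [mell_eq_fourier, Real.fourier_real_eq_integral_exp_smul]
  congr 1
  ext u
  rw [smul_eq_mul, ← mul_assoc, Complex.ofReal_exp, ← Complex.exp_add]
  congr 2
  conv_rhs => rw [← Complex.re_add_im s]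
  push_cast
  have : (Real.pi : ℂ) ≠ 0 := by exact_mod_cast Real.pi_ne_zero
  field_simp
  ring

/-- As `lift f` vanishes for u ≤ 0, the exponential may be redefined there. The even choice
e^(-x|u|) is what makes the Poisson kernel appear after Parseval. -/
theorem mell_eq_inner_poissonExp (f : ℝ → ℂ) (x y : ℝ) :
    mell f (x + y * Complex.I) = ∫ u, starRingEnd ℂ (poissonExp x y u) * lift f u := by
  rw [mell_eq_integral]
  congr 1
  ext u
  rcases le_or_gt u 0 with hu | hu
  · simp [lift_of_nonpos f hu]
  · congr 1
    rw [poissonExp, ← Complex.exp_conj, abs_of_pos hu]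
    congr 1
    simp
    ring

/-- The boundary function of the Mellin transform of `f`. -/
def bdry (f : L2) (t : ℝ) : ℂ :=
  (𝓕 ((memLp_lift f).toLp _) : Lp ℂ 2 (volume : Measure ℝ)) ((2 * Real.pi)⁻¹ * t)

theorem lintegral_comp_mul_left {a : ℝ} (ha : 0 < a) {F : ℝ → ℝ≥0∞} (hF : Measurable F) :
    ∫⁻ t, F (a * t) = ENNReal.ofReal a⁻¹ * ∫⁻ t, F t := by
  conv_rhs => rw [← Real.smul_map_volume_mul_left ha.ne']
  rw [lintegral_smul_measure, lintegral_map hF (measurable_const_mul a), smul_eq_mul, ← mul_assoc,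
    abs_of_pos ha, ← ENNReal.ofReal_mul (by positivity), inv_mul_cancel₀ ha.ne']
  simp

theorem stronglyMeasurable_bdry (f : L2) : StronglyMeasurable (bdry f) :=
  (Lp.stronglyMeasurable _).comp_measurable (measurable_const_mul _)

theorem lintegral_bdry_sq (f : L2) :
    ∫⁻ t, ‖bdry f t‖ₑ ^ 2 = ENNReal.ofReal (2 * Real.pi) * ‖f‖ₑ ^ 2 := by
  have hm : Measurable (fun t => ‖(𝓕 ((memLp_lift f).toLp _) : Lp ℂ 2 (volume : Measure ℝ)) t‖ₑ ^ 2) :=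
    ((Lp.stronglyMeasurable _).measurable.enorm).pow_const 2
  have h1 := lintegral_comp_mul_left (a := (2 * Real.pi)⁻¹) (by positivity) hm
  have h2 : ∫⁻ t, ‖lift f t‖ₑ ^ 2 = ‖(memLp_lift f).toLp _‖ₑ ^ 2 := by
    rw [← lintegral_enorm_sq_lp]
    refine lintegral_congr_ae ?_
    filter_upwards [(memLp_lift f).coeFn_toLp] with x hx
    rw [hx]
  simp only [bdry]
  rw [h1, lintegral_enorm_sq_lp, inv_inv, ← lintegral_lift_lp, h2, ← ofReal_norm, ← ofReal_norm,
    Lp.norm_fourier_eq]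

theorem memLp_bdry (f : L2) : MemLp (bdry f) 2 := by
  rw [memLp_two_iff (stronglyMeasurable_bdry f).aestronglyMeasurable, lintegral_bdry_sq]
  exact ENNReal.mul_lt_top ENNReal.ofReal_lt_top (by simp [ENNReal.pow_lt_top_iff])

theorem mell_eq_poisson (f : L2) {x : ℝ} (hx : 0 < x) (y : ℝ) :
    mell f (x + y * Complex.I)
      = ∫ t, ((Real.pi⁻¹ * (x / (x ^ 2 + (y - t) ^ 2)) : ℝ) : ℂ) * bdry f t := by
  rw [mell_eq_inner_poissonExp, integral_conj_mul_fourier (integrable_poissonExp hx y)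
    (memLp_poissonExp hx y) (memLp_lift f)]
  have hp : (0 : ℝ) < 2 * Real.pi := by positivity
  have h := Measure.integral_comp_mul_left (fun w : ℝ =>
    ((2 * x / (x ^ 2 + (y - 2 * Real.pi * w) ^ 2) : ℝ) : ℂ) *
      (𝓕 ((memLp_lift f).toLp _) : Lp ℂ 2 (volume : Measure ℝ)) w) (2 * Real.pi)⁻¹
  rw [inv_inv, abs_of_pos hp, eq_comm, ← eq_inv_smul_iff₀ hp.ne'] at h
  simp_rw [fourier_poissonExp hx, Complex.conj_ofReal]
  rw [h, ← integral_smul]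
  congr 1
  ext t
  rw [bdry, Complex.real_smul, ← mul_assoc, ← Complex.ofReal_mul, mul_inv_cancel_left₀ hp.ne']
  congr 2
  have := Real.pi_pos
  field_simp

/-! ### Injectivity, holomorphy and reproducing kernels. -/

/-- On one vertical line the Mellin transform is the Fourier transform of e^(-xu) times `lift f`, a
function in L¹ ∩ L², so Plancherel forces it to vanish. -/
theorem eq_zero_of_mell_eq_zero {f : L2} {x : ℝ} (hx : 0 < x)
    (hf : ∀ y : ℝ, mell f (x + y * Complex.I) = 0) : f = 0 := by
  set F : ℝ → ℂ := fun u => (Real.exp (-x * u) : ℂ) * lift f u with hF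
  have hFa : ∀ u, F u = (Real.exp (-x * |u|) : ℂ) * lift f u := by
    intro u
    rcases le_or_gt u 0 with hu | hu
    · simp [hF, lift_of_nonpos f hu]
    · simp [hF, abs_of_pos hu]
  have hl := memLp_lift f
  have hE := memLp_exp_neg_mul_abs hx
  have hm : AEStronglyMeasurable F := by
    refine AEStronglyMeasurable.mul ?_ hl.1
    exact (by fun_prop : Continuous (fun u : ℝ => (Real.exp (-x * u) : ℂ))).aestronglyMeasurable
  have h1 : Integrable F := by
    refine (hE.integrable_mul hl.norm).mono' hm (.of_forall fun u => ?_)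
    rw [hFa, norm_mul, Complex.norm_real, Real.norm_of_nonneg (Real.exp_pos _).le]
    rfl
  have h2 : MemLp F 2 := by
    refine hl.of_le hm (.of_forall fun u => ?_)
    rw [hFa, norm_mul, Complex.norm_real, Real.norm_of_nonneg (Real.exp_pos _).le]
    exact mul_le_of_le_one_left (norm_nonneg _) (Real.exp_le_one_iff.2 (by rw [neg_mul]; simpa using by positivity))
  have h3 : ∀ w, 𝓕 F w = 0 := by
    intro w
    have := mell_eq_fourier f x (2 * Real.pi * w)
    rw [mul_div_cancel_left₀ _ (by positivity), hf] at this
    exact this.symm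
  have h4 := lintegral_fourier_sq h1 h2
  simp only [h3, enorm_zero, ne_eq, OfNat.ofNat_ne_zero, not_false_eq_true, zero_pow,
    lintegral_zero] at h4
  have h5 : ∫⁻ u, ‖lift f u‖ₑ ^ 2 = 0 := by
    rw [eq_comm, lintegral_eq_zero_iff' (by fun_prop)] at h4
    rw [lintegral_eq_zero_iff' (hl.1.enorm.pow_const 2)]
    filter_upwards [h4] with u hu
    have : F u = 0 := by simpa using hu
    have : lift f u = 0 := by simpa [hF] using this
    simp [this]
  rw [lintegral_lift_lp] at h5
  simpa using h5

theorem differentiableOn_mell (f : L2) : DifferentiableOn ℂ (mell f) {s : ℂ | 0 < s.re} := by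
  intro s hs
  replace hs : 0 < s.re := hs
  have hl := memLp_lift f
  have hfun : mell f = fun s => ∫ u : ℝ, Complex.exp (-s * u) * lift f u :=
    funext fun s => mell_eq_integral f s
  rw [hfun]
  have hre : ∀ z ∈ Metric.ball s (s.re / 2), s.re / 2 < z.re := by
    intro z hz
    have := (Complex.abs_re_le_norm (z - s)).trans_lt (mem_ball_iff_norm.1 hz)
    rw [Complex.sub_re, abs_lt] at this
    linarith
  have hmeas : ∀ z : ℂ, AEStronglyMeasurable (fun u : ℝ => Complex.exp (-z * u) * lift f u) :=
    fun z => (by fun_prop : Continuous (fun u : ℝ =>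
      Complex.exp (-z * u))).aestronglyMeasurable.mul hl.1
  refine (hasDerivAt_integral_of_dominated_loc_of_deriv_le (μ := volume)
    (F := fun z (u : ℝ) => Complex.exp (-z * u) * lift f u)
    (F' := fun z (u : ℝ) => (-u : ℂ) * Complex.exp (-z * u) * lift f u)
    -- On the ball the exponential is at most e^(-u Re s/2); half of this exponent absorbs the
    -- factor u through t ≤ e^t with t = u Re s/4.
    (bound := fun u => (4 / s.re) * (Real.exp (-(s.re / 4) * |u|) * ‖lift f u‖))
    (Metric.ball_mem_nhds s (half_pos hs)) (.of_forall hmeas) ?_ ?_ ?_ ?_ ?_).2.differentiableAt.differentiableWithinAt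
  · refine ((memLp_exp_neg_mul_abs hs).integrable_mul hl.norm).mono' (hmeas s)
      (.of_forall fun u => ?_)
    rw [norm_mul, Complex.norm_exp]
    rcases le_or_gt u 0 with hu | hu
    · simp [lift_of_nonpos f hu]
    · simp [abs_of_pos hu]
  · exact (by fun_prop : Continuous (fun u : ℝ =>
      (-u : ℂ) * Complex.exp (-s * u))).aestronglyMeasurable.mul hl.1
  · refine .of_forall fun u z hz => ?_
    rcases le_or_gt u 0 with hu | hu
    · simp [lift_of_nonpos f hu]
    · rw [norm_mul, norm_mul, ← mul_assoc, Complex.norm_exp, abs_of_pos hu]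
      refine mul_le_mul_of_nonneg_right ?_ (norm_nonneg _)
      have e1 : ‖(-u : ℂ)‖ = u := by simp [abs_of_pos hu]
      have e2 : (-z * u).re = -z.re * u := by simp
      rw [e1, e2]
      have e3 : s.re / 4 * u ≤ Real.exp (s.re / 4 * u) := by
        linarith [Real.add_one_le_exp (s.re / 4 * u)]
      have e4 : Real.exp (-z.re * u) ≤ Real.exp (-(s.re / 4) * u) * Real.exp (-(s.re / 4) * u) := by
        rw [← Real.exp_add, Real.exp_le_exp]
        nlinarith [hre z hz]
      have e5 : Real.exp (s.re / 4 * u) * Real.exp (-(s.re / 4) * u) = 1 := by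
        rw [← Real.exp_add]; simp
      calc u * Real.exp (-z.re * u)
          ≤ u * (Real.exp (-(s.re / 4) * u) * Real.exp (-(s.re / 4) * u)) := by gcongr
        _ = (4 / s.re) * ((s.re / 4 * u) *
            (Real.exp (-(s.re / 4) * u) * Real.exp (-(s.re / 4) * u))) := by field_simp
        _ ≤ (4 / s.re) * (Real.exp (s.re / 4 * u) *
            (Real.exp (-(s.re / 4) * u) * Real.exp (-(s.re / 4) * u))) := by gcongr
        _ = 4 / s.re * Real.exp (-(s.re / 4) * u) := by rw [← mul_assoc (Real.exp _), e5, one_mul]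
  · exact ((memLp_exp_neg_mul_abs (by positivity)).integrable_mul hl.norm).const_mul _
  · refine .of_forall fun u z _ => ?_
    have : HasDerivAt (fun z : ℂ => Complex.exp (-z * u)) (Complex.exp (-z * u) * (-1 * u)) z :=
      ((hasDerivAt_neg z).mul_const (u : ℂ)).cexp
    convert! this.mul_const (lift f u) using 1
    ring

theorem inner_monomial (p : ℂ) (hp : -1 / 2 < p.re) (f : L2) :
    inner ℂ (monomial p hp) f = mell f (starRingEnd ℂ p + 1 / 2) := by
  rw [L2.inner_def, mell]
  refine integral_congr_ae ?_
  filter_upwards [(memLp_cpow hp).coeFn_toLp, ae_restrict_mem measurableSet_Ioo] with x hx hx'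
  rw [monomial, hx, RCLike.inner_apply, mul_comm, add_sub_cancel_right]
  congr 1
  rw [Complex.cpow_conj _ _ (by simp [Complex.arg_ofReal_of_nonneg hx'.1.le, Real.pi_pos.ne]),
    Complex.conj_ofReal]

theorem mell_monomial (p : ℂ) (hp : -1 / 2 < p.re) {s : ℂ} (hs : 0 < s.re) :
    mell (monomial p hp) s = 1 / (s + p + 1 / 2) := by
  have h1 : mell (monomial p hp) s = ∫ x in (0 : ℝ)..1, (x : ℂ) ^ (s + p - 1 / 2) := by
    rw [mell, intervalIntegral.integral_of_le zero_le_one, integral_Ioc_eq_integral_Ioo]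
    refine integral_congr_ae ?_
    filter_upwards [(memLp_cpow hp).coeFn_toLp, ae_restrict_mem measurableSet_Ioo] with x hx hx'
    rw [monomial, hx, ← Complex.cpow_add _ _ (by exact_mod_cast hx'.1.ne')]
    congr 1
    ring
  have h2 : (s + p - 1 / 2 + 1).re > 0 := by
    simp
    linarith
  have h3 : s + p - 1 / 2 + 1 ≠ 0 := fun h => by rw [h] at h2; simp at h2
  rw [h1, integral_cpow (Or.inl ?_)]
  · rw [Complex.ofReal_one, Complex.one_cpow, Complex.ofReal_zero, Complex.zero_cpow h3, sub_zero]
    congr 1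
    ring
  · simp at h2 ⊢
    linarith

/-! ### Almost everywhere convergence of Poisson integrals. -/

theorem hasDerivAt_neg_half_inv (v : ℝ) :
    HasDerivAt (fun v : ℝ => -(1 / 2) * (1 + v ^ 2)⁻¹) (v / (1 + v ^ 2) ^ 2) v := by
  have h0 : (1 + v ^ 2) ≠ 0 := by positivity
  have := (((hasDerivAt_id v).fun_pow 2).const_add 1).fun_inv h0
  convert! this.const_mul (-(1 / 2) : ℝ) using 1
  simp
  field_simp

theorem tendsto_inv_one_add_sq : Tendsto (fun v : ℝ => (1 + v ^ 2)⁻¹) atTop (𝓝 0) :=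
  tendsto_inv_atTop_zero.comp (tendsto_atTop_add_const_left _ _ (tendsto_pow_atTop two_ne_zero))

theorem integrableOn_poissonMix {c : ℝ} (hc : 0 ≤ c) :
    IntegrableOn (fun v : ℝ => v / (1 + v ^ 2) ^ 2) (Set.Ioi c) := by
  refine integrableOn_Ioi_deriv_of_nonneg' (fun v _ => hasDerivAt_neg_half_inv v)
    (fun v hv => ?_) (tendsto_inv_one_add_sq.const_mul _)
  have : 0 < v := hc.trans_lt hv
  positivity

theorem integral_poissonMix {c : ℝ} (hc : 0 ≤ c) :
    ∫ v in Set.Ioi c, v / (1 + v ^ 2) ^ 2 = (1 / 2) * (1 + c ^ 2)⁻¹ := by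
  rw [integral_Ioi_of_hasDerivAt_of_tendsto' (fun v _ => hasDerivAt_neg_half_inv v)
    (integrableOn_poissonMix hc) (tendsto_inv_one_add_sq.const_mul _)]
  ring

/-- The density expressing the Poisson kernel as a mixture of averages over intervals. -/
def mixDensity (v : ℝ) : ℝ := 4 / Real.pi * (v ^ 2 / (1 + v ^ 2) ^ 2)

theorem hasDerivAt_mixPrimitive (v : ℝ) :
    HasDerivAt (fun v : ℝ => 2 / Real.pi * (Real.arctan v - v * (1 + v ^ 2)⁻¹))
      (mixDensity v) v := by
  have h0 : (1 + v ^ 2) ≠ 0 := by positivity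
  have h1 := (((hasDerivAt_id v).fun_pow 2).const_add 1).fun_inv h0
  have h2 := ((Real.hasDerivAt_arctan v).sub ((hasDerivAt_id v).mul h1)).const_mul (2 / Real.pi)
  convert! h2 using 1
  simp [mixDensity]
  field_simp
  ring

theorem tendsto_mixPrimitive :
    Tendsto (fun v : ℝ => 2 / Real.pi * (Real.arctan v - v * (1 + v ^ 2)⁻¹)) atTop (𝓝 1) := by
  have h1 : Tendsto (fun v : ℝ => v * (1 + v ^ 2)⁻¹) atTop (𝓝 0) := by
    refine squeeze_zero' ?_ ?_ tendsto_inv_atTop_zero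
    · filter_upwards [eventually_gt_atTop 0] with v hv
      positivity
    · filter_upwards [eventually_gt_atTop 0] with v hv
      rw [← div_eq_mul_inv, div_le_iff₀ (by positivity)]
      field_simp
      linarith
  have h2 := (Real.tendsto_arctan_atTop.mono_right nhdsWithin_le_nhds)
  have := (h2.sub h1).const_mul (2 / Real.pi)
  convert this using 2
  field_simp
  ring

theorem integrableOn_mixDensity : IntegrableOn mixDensity (Set.Ioi 0) :=
  integrableOn_Ioi_deriv_of_nonneg' (fun v _ => hasDerivAt_mixPrimitive v)
    (fun v _ => by unfold mixDensity; positivity) tendsto_mixPrimitive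

theorem integral_mixDensity : ∫ v in Set.Ioi 0, mixDensity v = 1 := by
  rw [integral_Ioi_of_hasDerivAt_of_tendsto' (fun v _ => hasDerivAt_mixPrimitive v)
    integrableOn_mixDensity tendsto_mixPrimitive]
  simp

/-- The Poisson kernel of the right half-plane at `x + iy`. -/
def poissonKer (x y t : ℝ) : ℝ := Real.pi⁻¹ * (x / (x ^ 2 + (y - t) ^ 2))

theorem continuous_poissonKer {x : ℝ} (hx : 0 < x) (y : ℝ) : Continuous (poissonKer x y) := by
  unfold poissonKer
  refine continuous_const.mul (continuous_const.div (by fun_prop) fun t => ?_)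
  positivity

theorem poissonKer_nonneg {x : ℝ} (hx : 0 < x) (y t : ℝ) : 0 ≤ poissonKer x y t := by
  unfold poissonKer
  positivity

/-- Layer-cake formula: the kernel decreases in |y - t|, so it is a superposition of indicators of
the balls |y - t| < xv. This reduces Poisson integrals to averages over balls. -/
theorem poissonKer_eq (x y t : ℝ) (hx : 0 < x) :
    poissonKer x y t = ∫ v : ℝ, (Set.Ioi (|y - t| / x)).indicator
      (fun v => 2 / Real.pi / x * (v / (1 + v ^ 2) ^ 2)) v := by
  rw [integral_indicator measurableSet_Ioi, integral_const_mul, integral_poissonMix (by positivity),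
    poissonKer, div_pow, sq_abs]
  have := Real.pi_pos
  field_simp

theorem integrable_poissonKer {x : ℝ} (hx : 0 < x) (y : ℝ) : Integrable (poissonKer x y) := by
  have h1 := (integrable_inv_one_add_sq.comp_sub_right y).comp_mul_right' (inv_ne_zero hx.ne')
  have h2 := integrable_inv_one_add_sq.comp_mul_left' (inv_ne_zero hx.ne')
  have h3 := (h2.comp_sub_right y).const_mul (Real.pi⁻¹ * x⁻¹)
  refine h3.congr (.of_forall fun t => ?_)
  simp only [poissonKer]
  have : 0 < x ^ 2 + (y - t) ^ 2 := by positivity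
  have : 0 < 1 + (x⁻¹ * (t - y)) ^ 2 := by positivity
  have := Real.pi_pos
  field_simp
  ring

theorem integral_poissonKer {x : ℝ} (hx : 0 < x) (y : ℝ) : ∫ t, poissonKer x y t = 1 := by
  have h1 := integral_sub_right_eq_self (fun t : ℝ => (1 + (x⁻¹ * t) ^ 2)⁻¹) (μ := volume) y
  have h2 := Measure.integral_comp_mul_left (fun t : ℝ => (1 + t ^ 2)⁻¹) x⁻¹
  rw [h2, integral_univ_inv_one_add_sq, inv_inv, abs_of_pos hx, smul_eq_mul] at h1
  have h3 : ∀ t, poissonKer x y t = (Real.pi⁻¹ * x⁻¹) * (1 + (x⁻¹ * (t - y)) ^ 2)⁻¹ := by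
    intro t
    unfold poissonKer
    have : 0 < x ^ 2 + (y - t) ^ 2 := by positivity
    have : 0 < 1 + (x⁻¹ * (t - y)) ^ 2 := by positivity
    have := Real.pi_pos
    field_simp
    ring
  simp_rw [h3]
  rw [integral_const_mul, h1]
  have := Real.pi_pos
  field_simp

theorem poissonKer_le {x : ℝ} (hx : 0 < x) (y t : ℝ) : poissonKer x y t ≤ Real.pi⁻¹ * x⁻¹ := by
  unfold poissonKer
  gcongr
  rw [div_le_iff₀ (by positivity)]
  field_simp
  nlinarith [sq_nonneg (y - t)]

theorem memLp_poissonKer {x : ℝ} (hx : 0 < x) (y : ℝ) : MemLp (poissonKer x y) 2 := by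
  rw [memLp_two_iff_integrable_sq (continuous_poissonKer hx y).aestronglyMeasurable]
  refine ((integrable_poissonKer hx y).const_mul (Real.pi⁻¹ * x⁻¹)).mono'
    ((continuous_poissonKer hx y).pow 2).aestronglyMeasurable (.of_forall fun t => ?_)
  rw [Real.norm_of_nonneg (sq_nonneg _), sq]
  exact mul_le_mul_of_nonneg_right (poissonKer_le hx y t) (poissonKer_nonneg hx y t)

theorem integrable_poissonKer_mul {x : ℝ} (hx : 0 < x) (y : ℝ) {B : ℝ → ℂ} (hB : MemLp B 2) :
    Integrable (fun t => (poissonKer x y t : ℂ) * B t) := by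
  have h : MemLp (fun t => (poissonKer x y t : ℂ)) 2 := (memLp_poissonKer hx y).ofReal
  exact h.integrable_mul hB

/-- Fubini applied to the layer-cake formula of `poissonKer_eq`. -/
theorem integral_poissonKer_mul {x : ℝ} (hx : 0 < x) (y : ℝ) {B : ℝ → ℂ} (hB : MemLp B 2) :
    ∫ t, (poissonKer x y t : ℂ) * B t
      = ∫ v in Set.Ioi 0, (mixDensity v : ℂ) * ⨍ t in Metric.closedBall y (x * v), B t := by
  set F : ℝ → ℝ → ℂ := fun t v => ((Set.Ioi (|y - t| / x)).indicator
      (fun v => 2 / Real.pi / x * (v / (1 + v ^ 2) ^ 2)) v : ℝ) * B t with hF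
  have hset : MeasurableSet {p : ℝ × ℝ | |y - p.1| / x < p.2} :=
    measurableSet_lt (by fun_prop) (by fun_prop)
  have hmeas : AEStronglyMeasurable (Function.uncurry F) (volume.prod volume) := by
    have h1 : Function.uncurry F = fun p : ℝ × ℝ =>
        (({p : ℝ × ℝ | |y - p.1| / x < p.2}.indicator
          (fun p => 2 / Real.pi / x * (p.2 / (1 + p.2 ^ 2) ^ 2)) p : ℝ) : ℂ) * B p.1 := by
      ext p
      simp only [Function.uncurry, hF, Set.indicator]
      rfl
    rw [h1]
    refine AEStronglyMeasurable.mul ?_ hB.1.comp_fst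
    refine Measurable.aestronglyMeasurable ?_
    refine Complex.measurable_ofReal.comp (Measurable.indicator ?_ hset)
    fun_prop
  have hind : ∀ t, Integrable ((Set.Ioi (|y - t| / x)).indicator
      (fun v => 2 / Real.pi / x * (v / (1 + v ^ 2) ^ 2))) := fun t =>
    (integrable_indicator_iff measurableSet_Ioi).2
      ((integrableOn_poissonMix (by positivity)).const_mul _)
  have hnonneg : ∀ t v, 0 ≤ (Set.Ioi (|y - t| / x)).indicator
      (fun v => 2 / Real.pi / x * (v / (1 + v ^ 2) ^ 2)) v := by
    intro t v
    refine Set.indicator_apply_nonneg fun hv => ?_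
    have : 0 ≤ v := (by positivity : 0 ≤ |y - t| / x).trans (Set.mem_Ioi.1 hv).le
    have := Real.pi_pos
    positivity
  have hint : Integrable (Function.uncurry F) (volume.prod volume) := by
    rw [integrable_prod_iff hmeas]
    refine ⟨.of_forall fun t => ((hind t).ofReal (𝕜 := ℂ)).mul_const (B t), ?_⟩
    refine (integrable_poissonKer_mul hx y hB).norm.congr (.of_forall fun t => ?_)
    simp only [Function.uncurry, hF, norm_mul, Complex.norm_real]
    rw [integral_mul_const, Real.norm_of_nonneg (poissonKer_nonneg hx y t), poissonKer_eq x y t hx]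
    congr 2
    ext v
    rw [Real.norm_of_nonneg (hnonneg t v)]
  have h1 : ∀ t, (poissonKer x y t : ℂ) * B t = ∫ v, F t v := by
    intro t
    simp only [hF]
    rw [integral_mul_const, poissonKer_eq x y t hx, integral_complex_ofReal]
  simp_rw [h1]
  rw [integral_integral_swap hint, ← integral_indicator measurableSet_Ioi]
  congr 1
  ext v
  rcases le_or_gt v 0 with hv | hv
  · have : ∀ t, F t v = 0 := by
      intro t
      have : v ∉ Set.Ioi (|y - t| / x) := fun h => by
        have : 0 ≤ |y - t| / x := by positivity
        linarith [Set.mem_Ioi.1 h]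
      simp [hF, Set.indicator_of_notMem this]
    simp [this, hv]
  · rw [Set.indicator_of_mem (Set.mem_Ioi.2 hv)]
    have : ∀ t, F t v = (Metric.ball y (x * v)).indicator
        (fun t => (2 / Real.pi / x * (v / (1 + v ^ 2) ^ 2) : ℝ) * B t) t := by
      intro t
      have : v ∈ Set.Ioi (|y - t| / x) ↔ t ∈ Metric.ball y (x * v) := by
        rw [Set.mem_Ioi, div_lt_iff₀ hx, Metric.mem_ball, Real.dist_eq, abs_sub_comm, mul_comm]
      simp only [hF]
      by_cases h : t ∈ Metric.ball y (x * v)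
      · rw [Set.indicator_of_mem h, Set.indicator_of_mem (this.2 h)]
      · rw [Set.indicator_of_notMem h, Set.indicator_of_notMem (mt this.1 h), Complex.ofReal_zero,
          zero_mul]
    simp_rw [this]
    rw [integral_indicator measurableSet_ball, integral_const_mul, setAverage_eq,
      Real.closedBall_eq_Icc, Real.ball_eq_Ioo, integral_Icc_eq_integral_Ioo, Real.volume_real_Icc_of_le
        (by nlinarith), Complex.real_smul, ← mul_assoc, ← Complex.ofReal_mul]
    congr 2
    -- The length 2xv of the ball multiplies the layer weight (2/(πx)) v/(1+v²)² and yields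
    -- `mixDensity`, free of x.
    unfold mixDensity
    have := Real.pi_pos
    field_simp
    ring

/-- Lebesgue differentiation gives convergence of the ball averages for each v, and `mixDensity` has
mass one. Dominated convergence needs a bound on the averages for all radii: small radii are covered
by convergence, large ones by |B| ≤ 1 + |B|² with |B|² integrable. -/
theorem ae_tendsto_poisson {B : ℝ → ℂ} (hB : MemLp B 2) :
    ∀ᵐ y : ℝ, Tendsto (fun x : ℝ => ∫ t, (poissonKer x y t : ℂ) * B t) (𝓝[>] 0) (𝓝 (B y)) := by
  filter_upwards [IsUnifLocDoublingMeasure.ae_tendsto_average volume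
    (hB.locallyIntegrable (by norm_num)) 0] with y hy
  have hA : Tendsto (fun r => ⨍ t in Metric.closedBall y r, B t) (𝓝[>] 0) (𝓝 (B y)) :=
    hy (fun _ => y) id tendsto_id (.of_forall fun r => by simp)
  obtain ⟨δ, hδ, hδA⟩ : ∃ δ > 0, ∀ r, 0 < r → r < δ →
      ‖⨍ t in Metric.closedBall y r, B t‖ ≤ ‖B y‖ + 1 := by
    have h1 := hA.norm.eventually (gt_mem_nhds (lt_add_one ‖B y‖))
    rw [eventually_nhdsWithin_iff, Metric.eventually_nhds_iff] at h1
    obtain ⟨δ, hδ, h⟩ := h1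
    refine ⟨δ, hδ, fun r hr hrδ => (h ?_ hr).le⟩
    rwa [Real.dist_eq, sub_zero, abs_of_pos hr]
  have hsq : Integrable (fun t => ‖B t‖ ^ 2) := (memLp_two_iff_integrable_sq_norm hB.1).1 hB
  set S := ∫ t, ‖B t‖ ^ 2
  have hS : 0 ≤ S := integral_nonneg fun t => sq_nonneg _
  have hbig : ∀ r, δ ≤ r → ‖⨍ t in Metric.closedBall y r, B t‖ ≤ 1 + S / δ := by
    intro r hr
    have hr0 : 0 < r := hδ.trans_le hr
    rw [setAverage_eq, Real.closedBall_eq_Icc, Real.volume_real_Icc_of_le (by linarith), norm_smul,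
      Real.norm_of_nonneg (by rw [inv_nonneg]; linarith), inv_mul_le_iff₀ (by linarith)]
    have hi : IntegrableOn (fun _ : ℝ => (1 : ℝ)) (Set.Icc (y - r) (y + r)) := by simp
    calc ‖∫ t in Set.Icc (y - r) (y + r), B t‖
        ≤ ∫ t in Set.Icc (y - r) (y + r), (1 + ‖B t‖ ^ 2) := by
          refine norm_integral_le_of_norm_le (hi.add hsq.integrableOn) (.of_forall fun t => ?_)
          nlinarith [sq_nonneg (‖B t‖ - 1), norm_nonneg (B t)]
      _ = 2 * r + ∫ t in Set.Icc (y - r) (y + r), ‖B t‖ ^ 2 := by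
          rw [integral_add hi hsq.integrableOn]
          congr 1
          simp
          rw [max_eq_left (by linarith)]
          ring
      _ ≤ 2 * r + S := by
          gcongr
          exact setIntegral_le_integral hsq (.of_forall fun t => sq_nonneg _)
      _ ≤ (y + r - (y - r)) * (1 + S / δ) := by
          have : S ≤ r * (S / δ) := by
            calc S = δ * (S / δ) := by field_simp
              _ ≤ r * (S / δ) := by gcongr
          nlinarith [div_nonneg hS hδ.le]
  set C := max (‖B y‖ + 1) (1 + S / δ)
  have hC : ∀ r, 0 < r → ‖⨍ t in Metric.closedBall y r, B t‖ ≤ C := by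
    intro r hr
    rcases lt_or_ge r δ with h | h
    · exact (hδA r hr h).trans (le_max_left _ _)
    · exact (hbig r h).trans (le_max_right _ _)
  have hlim : Tendsto (fun x : ℝ => ∫ v in Set.Ioi 0, (mixDensity v : ℂ) *
      ⨍ t in Metric.closedBall y (x * v), B t) (𝓝[>] 0)
      (𝓝 (∫ v in Set.Ioi 0, (mixDensity v : ℂ) * B y)) := by
    refine tendsto_integral_filter_of_dominated_convergence (fun v => mixDensity v * C) ?_ ?_
      (integrableOn_mixDensity.mul_const C) ?_
    · filter_upwards [self_mem_nhdsWithin] with x hx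
      have hx : 0 < x := hx
      refine AEStronglyMeasurable.mul ?_ ?_
      · refine Measurable.aestronglyMeasurable ?_
        unfold mixDensity
        fun_prop
      · have hc : Continuous (fun r : ℝ => ∫ t in (y - r)..(y + r), B t) := by
          have h0 : ∀ a b : ℝ, IntervalIntegrable B volume a b := fun a b =>
            intervalIntegrable_iff.mpr <| ((hB.locallyIntegrable (by norm_num)).integrableOn_isCompact
              isCompact_uIcc).mono_set Set.uIoc_subset_uIcc
          have h1 := intervalIntegral.continuous_primitive h0 0
          have h2 : (fun r : ℝ => ∫ t in (y - r)..(y + r), B t) =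
              fun r => (∫ t in (0 : ℝ)..(y + r), B t) - ∫ t in (0 : ℝ)..(y - r), B t := by
            ext r
            rw [intervalIntegral.integral_interval_sub_left (h0 _ _) (h0 _ _)]
          rw [h2]
          exact (h1.comp (by fun_prop)).sub (h1.comp (by fun_prop))
        have hm : Measurable (fun v : ℝ => ((2 * (x * v))⁻¹ : ℝ) • ∫ t in (y - x * v)..(y + x * v), B t) := by
          refine Measurable.smul (f := fun v : ℝ => (2 * (x * v))⁻¹) (by fun_prop) ?_
          exact (hc.comp (by fun_prop : Continuous fun v : ℝ => x * v)).measurable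
        refine hm.aestronglyMeasurable.congr ?_
        filter_upwards [ae_restrict_mem measurableSet_Ioi] with v hv
        have hv : 0 < v := hv
        have hxv : 0 < x * v := mul_pos hx hv
        rw [setAverage_eq, Real.closedBall_eq_Icc, Real.volume_real_Icc_of_le (by linarith),
          integral_Icc_eq_integral_Ioc, intervalIntegral.integral_of_le (by linarith)]
        congr 2
        ring
    · filter_upwards [self_mem_nhdsWithin] with x hx
      filter_upwards [ae_restrict_mem measurableSet_Ioi] with v hv
      have hm : 0 ≤ mixDensity v := by unfold mixDensity; positivity
      rw [norm_mul, Complex.norm_real, Real.norm_of_nonneg hm]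
      exact mul_le_mul_of_nonneg_left (hC _ (mul_pos hx hv)) hm
    · filter_upwards [ae_restrict_mem measurableSet_Ioi] with v hv
      refine (hA.comp ?_).const_mul _
      have hv : 0 < v := hv
      refine tendsto_nhdsWithin_iff.2 ⟨?_, ?_⟩
      · have : Tendsto (fun x : ℝ => x * v) (𝓝 0) (𝓝 (0 * v)) := tendsto_id.mul_const v
        rw [zero_mul] at this
        exact this.mono_left nhdsWithin_le_nhds
      · filter_upwards [self_mem_nhdsWithin] with x hx using mul_pos hx hv
  rw [integral_mul_const, integral_complex_ofReal, integral_mixDensity, Complex.ofReal_one,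
    one_mul] at hlim
  refine hlim.congr' ?_
  filter_upwards [self_mem_nhdsWithin] with x hx
  exact (integral_poissonKer_mul hx y hB).symm

theorem ae_tendsto_mell (f : L2) :
    ∀ᵐ y : ℝ, Tendsto (fun x : ℝ => mell f (x + y * Complex.I)) (𝓝[>] 0) (𝓝 (bdry f y)) := by
  filter_upwards [ae_tendsto_poisson (memLp_bdry f)] with y hy
  refine hy.congr' ?_
  filter_upwards [self_mem_nhdsWithin] with x hx
  rw [mell_eq_poisson f hx]
  rfl

/-! ### Blaschke products and zeros of bounded functions. -/

theorem isOpen_rightHalfPlane : IsOpen {s : ℂ | 0 < s.re} :=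
  isOpen_lt continuous_const Complex.continuous_re

theorem add_ofReal_ne_zero {s : ℂ} (hs : 0 < s.re) {r : ℝ} (hr : 0 < r) : s + r ≠ 0 := fun h => by
  have := congrArg Complex.re h
  simp at this
  linarith

theorem norm_sq_sub_add (s : ℂ) (r : ℝ) : ‖s - r‖ ^ 2 = ‖s + r‖ ^ 2 - 4 * s.re * r := by
  rw [← Complex.normSq_eq_norm_sq, ← Complex.normSq_eq_norm_sq, Complex.normSq_apply,
    Complex.normSq_apply]
  simp
  ring

/-- The Schwarz lemma in the right half-plane. -/
theorem norm_le_mul_of_zero {f : ℂ → ℂ} {M : ℝ} (hf : DifferentiableOn ℂ f {s : ℂ | 0 < s.re})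
    (hM : ∀ s : ℂ, 0 < s.re → ‖f s‖ ≤ M) {r : ℝ} (hr : 0 < r) (h0 : f r = 0) {s : ℂ}
    (hs : 0 < s.re) : ‖f s‖ ≤ M * ‖(s - r) / (s + r)‖ := by
  -- The Cayley map from the disc onto the half-plane with 0 ↦ r; its inverse is s ↦ (s - r)/(s +
  -- r).
  set ψ : ℂ → ℂ := fun w => r * (1 + w) / (1 - w) with hψ
  have hne : ∀ w ∈ Metric.ball (0 : ℂ) 1, 1 - w ≠ 0 := by
    intro w hw h
    rw [mem_ball_zero_iff, ← sub_eq_zero.1 h] at hw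
    simp at hw
  have hre : ∀ w ∈ Metric.ball (0 : ℂ) 1, 0 < (ψ w).re := by
    intro w hw
    have h1 := mem_ball_zero_iff.1 hw
    have h2 : (ψ w).re = r * (1 - ‖w‖ ^ 2) / Complex.normSq (1 - w) := by
      simp only [hψ, Complex.div_re, ← Complex.normSq_eq_norm_sq, Complex.normSq_apply w]
      simp
      ring
    rw [h2]
    have h3 : 0 < Complex.normSq (1 - w) := Complex.normSq_pos.2 (hne w hw)
    have h4 : 0 < 1 - ‖w‖ ^ 2 := by nlinarith [norm_nonneg w]
    positivity
  have hd : DifferentiableOn ℂ (f ∘ ψ) (Metric.ball 0 1) := by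
    refine hf.comp (fun w hw => ?_) hre
    refine DifferentiableAt.differentiableWithinAt ?_
    exact (by fun_prop : DifferentiableAt ℂ (fun w : ℂ => (r : ℂ) * (1 + w)) w).div (by fun_prop) (hne w hw)
  have hψ0 : (f ∘ ψ) 0 = 0 := by simp [hψ, h0]
  have hsr := add_ofReal_ne_zero hs hr
  have hw : (s - r) / (s + r) ∈ Metric.ball (0 : ℂ) 1 := by
    rw [mem_ball_zero_iff, norm_div, div_lt_one (norm_pos_iff.2 hsr)]
    refine lt_of_pow_lt_pow_left₀ 2 (norm_nonneg _) ?_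
    rw [norm_sq_sub_add]
    nlinarith [mul_pos hs hr]
  have hψs : ψ ((s - r) / (s + r)) = s := by
    have h1 : 1 - (s - r) / (s + r) = 2 * r / (s + r) := by field_simp; ring
    have h2 : 1 + (s - r) / (s + r) = 2 * s / (s + r) := by field_simp; ring
    have h3 : (r : ℂ) ≠ 0 := by exact_mod_cast hr.ne'
    simp only [hψ, h1, h2]
    field_simp
  have := Complex.dist_le_div_mul_dist_of_mapsTo_ball (R₂ := M) hd (fun w hw => by
    rw [hψ0, mem_closedBall_zero_iff]
    exact hM _ (hre w hw)) hw
  rw [hψ0, dist_zero_right, dist_zero_right, div_one, Function.comp_apply, hψs] at this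
  exact this

/-- By the Schwarz lemma, dividing by one Blaschke factor does not increase the bound `M`, so zeros
can be removed one at a time. The sequence is shifted after each division, which is why `f` and `r`
are quantified inside the induction. -/
theorem norm_le_mul_prod_of_zeros {M : ℝ} (N : ℕ) : ∀ {f : ℂ → ℂ} {r : ℕ → ℝ},
    DifferentiableOn ℂ f {s : ℂ | 0 < s.re} → (∀ s : ℂ, 0 < s.re → ‖f s‖ ≤ M) →
    (∀ n, 0 < r n) → Function.Injective r → (∀ n, f (r n) = 0) → ∀ {s : ℂ}, 0 < s.re →
    ‖f s‖ ≤ M * ∏ n ∈ Finset.range N, ‖(s - r n) / (s + r n)‖ := by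
  induction N with
  | zero =>
    intro f r _ hM _ _ _ s hs
    simpa using hM s hs
  | succ N ih =>
    intro f r hf hM hr hinj h0 s hs
    -- The quotient of `f` by its Blaschke factor, with `dslope` filling the removable singularity;
    -- the bound at `r 0` itself follows by continuity.
    set g : ℂ → ℂ := fun s => dslope f (r 0) s * (s + r 0) with hg
    have hmem : {s : ℂ | 0 < s.re} ∈ 𝓝 (r 0 : ℂ) :=
      isOpen_rightHalfPlane.mem_nhds (by simpa using hr 0)
    have hgd : DifferentiableOn ℂ g {s : ℂ | 0 < s.re} :=
      ((Complex.differentiableOn_dslope hmem).2 hf).mul (by fun_prop)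
    have hfg : ∀ s : ℂ, 0 < s.re → f s = g s * ((s - r 0) / (s + r 0)) := by
      intro s hs
      have h1 := sub_smul_dslope f (r 0 : ℂ) s
      rw [h0, sub_zero, smul_eq_mul] at h1
      have := add_ofReal_ne_zero hs (hr 0)
      rw [← h1]
      simp only [hg]
      field_simp
    have hgM' : ∀ s : ℂ, 0 < s.re → s ≠ r 0 → ‖g s‖ ≤ M := by
      intro s hs hne
      have h1 := norm_le_mul_of_zero hf hM (hr 0) (h0 0) hs
      rw [hfg s hs, norm_mul] at h1
      refine le_of_mul_le_mul_right h1 (norm_pos_iff.2 ?_)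
      exact div_ne_zero (sub_ne_zero.2 hne) (add_ofReal_ne_zero hs (hr 0))
    have hgM : ∀ s : ℂ, 0 < s.re → ‖g s‖ ≤ M := by
      intro s hs
      by_cases hne : s = r 0
      · have hc : ContinuousAt g s :=
          hgd.continuousOn.continuousAt (isOpen_rightHalfPlane.mem_nhds hs)
        refine le_of_tendsto (hc.norm.mono_left (nhdsWithin_le_nhds (s := {s}ᶜ))) ?_
        filter_upwards [self_mem_nhdsWithin,
          nhdsWithin_le_nhds (isOpen_rightHalfPlane.mem_nhds hs)] with z hz hz'
        exact hgM' z hz' (by rw [← hne]; exact hz)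
      · exact hgM' s hs hne
    have hg0 : ∀ n, g (r (n + 1)) = 0 := by
      intro n
      have hne : (r (n + 1) : ℂ) ≠ r 0 := by
        intro h
        have := hinj (Complex.ofReal_injective h)
        omega
      have hp : 0 < ((r (n + 1) : ℝ) : ℂ).re := by simpa using hr (n + 1)
      have h1 := hfg _ hp
      rw [h0, eq_comm, mul_eq_zero] at h1
      exact h1.resolve_right (div_ne_zero (sub_ne_zero.2 hne) (add_ofReal_ne_zero hp (hr 0)))
    have := ih (r := fun n => r (n + 1)) hgd hgM (fun n => hr _)
      (hinj.comp (add_left_injective 1)) hg0 hs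
    rw [hfg s hs, norm_mul, Finset.prod_range_succ', ← mul_assoc]
    gcongr

/-- A bounded holomorphic function in the right half-plane vanishing at the points `n + 1/2`
is zero. -/
theorem eq_zero_of_bounded_of_zeros {f : ℂ → ℂ} {M : ℝ}
    (hf : DifferentiableOn ℂ f {s : ℂ | 0 < s.re}) (hM : ∀ s : ℂ, 0 < s.re → ‖f s‖ ≤ M)
    (h0 : ∀ n : ℕ, f (n + 1 / 2) = 0) {s : ℂ} (hs : 0 < s.re) : f s = 0 := by
  set r : ℕ → ℝ := fun n => n + 1 / 2 with hr
  have hrpos : ∀ n, 0 < r n := fun n => by simp only [hr]; positivity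
  have hrinj : Function.Injective r := fun m n h => by simpa [hr] using h
  have hr0 : ∀ n, f (r n) = 0 := fun n => by rw [← h0 n]; congr 1; simp [hr]
  -- From 1 - |(s-r)/(s+r)|² = 4 r Re s/|s+r|², with r = n + 1/2 ≥ (n+1)/2 and |s+r| ≤ (n+1)(|s|+1),
  -- each defect is at least c/(n+1); the harmonic series then drives the product to zero.
  set c : ℝ := 2 * s.re / (‖s‖ + 1) ^ 2 with hc
  have hcpos : 0 < c := by positivity
  have hfac : ∀ n : ℕ, ‖(s - r n) / (s + r n)‖ ^ 2 ≤ Real.exp (-(c * (1 / ((n : ℝ) + 1)))) := by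
    intro n
    have hne := add_ofReal_ne_zero hs (hrpos n)
    have hpos : 0 < ‖s + r n‖ ^ 2 := by positivity
    have h1 : ‖(s - r n) / (s + r n)‖ ^ 2 = 1 - 4 * s.re * r n / ‖s + r n‖ ^ 2 := by
      rw [norm_div, div_pow, norm_sq_sub_add]
      field_simp
    have h2 : ‖s + r n‖ ≤ (n + 1) * (‖s‖ + 1) := by
      refine (norm_add_le _ _).trans ?_
      rw [Complex.norm_real, Real.norm_of_nonneg (hrpos n).le]
      simp only [hr]
      nlinarith [norm_nonneg s, n.cast_nonneg (α := ℝ)]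
    have h3 : c * (1 / ((n : ℝ) + 1)) ≤ 4 * s.re * r n / ‖s + r n‖ ^ 2 := by
      calc c * (1 / ((n : ℝ) + 1))
          = 4 * s.re * ((n + 1) / 2) / ((n + 1) * (‖s‖ + 1)) ^ 2 := by
            rw [hc]
            field_simp
            ring
        _ ≤ 4 * s.re * r n / ‖s + r n‖ ^ 2 := by
            gcongr
            simp only [hr]
            linarith
    rw [h1]
    linarith [Real.add_one_le_exp (-(c * (1 / ((n : ℝ) + 1)))),
      Real.one_sub_le_exp_neg (4 * s.re * r n / ‖s + r n‖ ^ 2),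
      Real.exp_le_exp.2 (neg_le_neg h3)]
  have hMn : 0 ≤ M := (norm_nonneg _).trans (hM s hs)
  have hbound : ∀ N : ℕ, ‖f s‖ ^ 2
      ≤ M ^ 2 * Real.exp (-(c * ∑ n ∈ Finset.range N, 1 / ((n : ℝ) + 1))) := by
    intro N
    have h1 := norm_le_mul_prod_of_zeros N hf hM hrpos hrinj hr0 hs
    calc ‖f s‖ ^ 2 ≤ (M * ∏ n ∈ Finset.range N, ‖(s - r n) / (s + r n)‖) ^ 2 := by gcongr
      _ = M ^ 2 * ∏ n ∈ Finset.range N, ‖(s - r n) / (s + r n)‖ ^ 2 := by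
          rw [mul_pow, Finset.prod_pow]
      _ ≤ M ^ 2 * ∏ n ∈ Finset.range N, Real.exp (-(c * (1 / ((n : ℝ) + 1)))) := by
          gcongr with n _
          exact hfac n
      _ = _ := by
          rw [← Real.exp_sum, Finset.sum_neg_distrib, Finset.mul_sum]
  have hlim : Tendsto (fun N : ℕ =>
      M ^ 2 * Real.exp (-(c * ∑ n ∈ Finset.range N, 1 / ((n : ℝ) + 1)))) atTop (𝓝 (M ^ 2 * 0)) := by
    refine Tendsto.const_mul _ (Real.tendsto_exp_neg_atTop_nhds_zero.comp ?_)
    exact Real.tendsto_sum_range_one_div_nat_succ_atTop.const_mul_atTop hcpos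
  have := ge_of_tendsto' hlim hbound
  rw [mul_zero] at this
  have h := pow_eq_zero_iff two_ne_zero |>.1 (le_antisymm this (sq_nonneg _))
  exact norm_eq_zero.1 h

/-! ### Herglotz integrals, outer functions and uniqueness of `h`. -/

/-- The Cauchy transform of an integrable function on the imaginary axis. -/
def cauchyTransform (m : ℝ → ℝ) (s : ℂ) : ℂ := ∫ t : ℝ, (s - t * Complex.I)⁻¹ * m t

theorem re_le_norm_sub_mul_I (s : ℂ) (t : ℝ) : s.re ≤ ‖s - t * Complex.I‖ := by
  have := Complex.re_le_norm (s - t * Complex.I)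
  simpa using this

theorem sub_mul_I_ne_zero {s : ℂ} (hs : 0 < s.re) (t : ℝ) : s - t * Complex.I ≠ 0 :=
  norm_pos_iff.1 (hs.trans_le (re_le_norm_sub_mul_I s t))

theorem norm_inv_sub_mul_I_le {s : ℂ} (hs : 0 < s.re) (t : ℝ) :
    ‖(s - t * Complex.I)⁻¹‖ ≤ s.re⁻¹ := by
  rw [norm_inv]
  exact inv_anti₀ hs (re_le_norm_sub_mul_I s t)

theorem continuous_inv_sub_mul_I {s : ℂ} (hs : 0 < s.re) :
    Continuous (fun t : ℝ => (s - t * Complex.I)⁻¹) :=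
  (by fun_prop : Continuous (fun t : ℝ => s - t * Complex.I)).inv₀ (sub_mul_I_ne_zero hs)

theorem integrable_cauchyTransform {m : ℝ → ℝ} (hm : Integrable m) {s : ℂ} (hs : 0 < s.re) :
    Integrable (fun t : ℝ => (s - t * Complex.I)⁻¹ * (m t : ℂ)) :=
  (hm.ofReal (𝕜 := ℂ)).bdd_mul (c := s.re⁻¹) (continuous_inv_sub_mul_I hs).aestronglyMeasurable
    (.of_forall (norm_inv_sub_mul_I_le hs))

theorem differentiableOn_cauchyTransform {m : ℝ → ℝ} (hm : Integrable m) :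
    DifferentiableOn ℂ (cauchyTransform m) {s : ℂ | 0 < s.re} := by
  intro s hs
  replace hs : 0 < s.re := hs
  have hre : ∀ z ∈ Metric.ball s (s.re / 2), s.re / 2 < z.re := by
    intro z hz
    have := (Complex.abs_re_le_norm (z - s)).trans_lt (mem_ball_iff_norm.1 hz)
    rw [Complex.sub_re, abs_lt] at this
    linarith
  refine (hasDerivAt_integral_of_dominated_loc_of_deriv_le (μ := volume)
    (F := fun z (t : ℝ) => (z - t * Complex.I)⁻¹ * (m t : ℂ))
    (F' := fun z (t : ℝ) => (-1 / (z - t * Complex.I) ^ 2) * (m t : ℂ))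
    (bound := fun t => ((s.re / 2)⁻¹) ^ 2 * ‖m t‖)
    (Metric.ball_mem_nhds s (half_pos hs)) ?_ (integrable_cauchyTransform hm hs) ?_ ?_
    (hm.norm.const_mul _) ?_).2.differentiableAt.differentiableWithinAt
  · filter_upwards [isOpen_rightHalfPlane.mem_nhds hs] with z hz
    exact (integrable_cauchyTransform hm hz).1
  · refine AEStronglyMeasurable.mul (Continuous.aestronglyMeasurable ?_) hm.ofReal.1
    exact continuous_const.div (by fun_prop) fun t => pow_ne_zero _ (sub_mul_I_ne_zero hs t)
  · refine .of_forall fun t z hz => ?_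
    have hz' := hre z hz
    have hz0 : 0 < z.re := (half_pos hs).trans hz'
    rw [norm_mul, norm_div, norm_neg, norm_one, norm_pow, one_div, ← inv_pow, Complex.norm_real,
      ← norm_inv]
    gcongr
    exact (norm_inv_sub_mul_I_le hz0 t).trans (inv_anti₀ (half_pos hs) hz'.le)
  · refine .of_forall fun t z hz => ?_
    have hz0 : 0 < z.re := (half_pos hs).trans (hre z hz)
    exact (((hasDerivAt_id z).sub_const (t * Complex.I)).fun_inv (sub_mul_I_ne_zero hz0 t)).mul_const _

/-- The holomorphic function in the right half-plane whose real part is the Poisson integral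
of `u`. -/
def herglotz (u : ℝ → ℝ) (s : ℂ) : ℂ :=
  s * (∫ t, Real.pi⁻¹ * (u t / (1 + t ^ 2)) : ℝ)
    + (1 - s ^ 2) * cauchyTransform (fun t => Real.pi⁻¹ * (u t / (1 + t ^ 2))) s

theorem differentiableOn_herglotz {u : ℝ → ℝ} (hu : Integrable (fun t => u t / (1 + t ^ 2))) :
    DifferentiableOn ℂ (herglotz u) {s : ℂ | 0 < s.re} := by
  have h1 := differentiableOn_cauchyTransform (hu.const_mul Real.pi⁻¹)
  unfold herglotz
  fun_prop

/-- The kernel is 1/(s - it) minus the purely imaginary it/(1 + t²), up to the factor 1/π, so its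
real part is Poisson's. The correction makes it integrable against every u with u/(1+t²) integrable,
and the chosen splitting uses only Cauchy transforms of L¹ functions. -/
theorem herglotz_kernel_re {x y : ℝ} (hx : 0 < x) (t c : ℝ) :
    (((x + y * Complex.I : ℂ) * (Real.pi⁻¹ * (c / (1 + t ^ 2)) : ℝ)) +
      (1 - (x + y * Complex.I : ℂ) ^ 2) * ((x + y * Complex.I - t * Complex.I : ℂ)⁻¹ *
        (Real.pi⁻¹ * (c / (1 + t ^ 2)) : ℝ))).re = poissonKer x y t * c := by
  set r : ℝ := Real.pi⁻¹ * (c / (1 + t ^ 2)) with hr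
  set D : ℝ := x ^ 2 + (y - t) ^ 2 with hD
  have hd : 0 < D := by positivity
  have hne : (D : ℂ) ≠ 0 := by exact_mod_cast hd.ne'
  have hsne : (x + y * Complex.I - t * Complex.I : ℂ) ≠ 0 :=
    sub_mul_I_ne_zero (s := x + y * Complex.I) (by simpa using hx) t
  have h1 : (x + y * Complex.I - t * Complex.I : ℂ) * (x - (y - t) * Complex.I) = D := by
    rw [hD]
    push_cast
    ring_nf
    simp only [Complex.I_sq]
    ring
  have h2 : ((x + y * Complex.I : ℂ) * r) +
      (1 - (x + y * Complex.I : ℂ) ^ 2) * ((x + y * Complex.I - t * Complex.I : ℂ)⁻¹ * r)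
      = ((x + y * Complex.I) * D + (1 - (x + y * Complex.I : ℂ) ^ 2) * (x - (y - t) * Complex.I))
        * ((r / D : ℝ) : ℂ) := by
    rw [inv_eq_of_mul_eq_one_right
      (b := (x - (y - t) * Complex.I) / (D : ℂ)) (by rw [← mul_div_assoc, h1, div_self hne])]
    push_cast
    field_simp
  have h3 : ((x + y * Complex.I) * D + (1 - (x + y * Complex.I : ℂ) ^ 2) *
      (x - (y - t) * Complex.I)).re = x * (1 + t ^ 2) := by
    simp [pow_two, hD]
    ring
  rw [h2, Complex.re_mul_ofReal, h3, hr, poissonKer, ← hD]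
  field_simp

theorem re_herglotz {u : ℝ → ℝ} (hu : Integrable (fun t => u t / (1 + t ^ 2))) {x : ℝ} (hx : 0 < x)
    (y : ℝ) : (herglotz u (x + y * Complex.I)).re = poissonIntegral u x y ∧
      Integrable (fun t => poissonKer x y t * u t) := by
  have hs : 0 < (x + y * Complex.I : ℂ).re := by simpa using hx
  have hm := hu.const_mul Real.pi⁻¹
  have i1 : Integrable (fun t : ℝ => (x + y * Complex.I : ℂ) *
      ((Real.pi⁻¹ * (u t / (1 + t ^ 2)) : ℝ) : ℂ)) := (hm.ofReal (𝕜 := ℂ)).const_mul _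
  have i2 := (integrable_cauchyTransform hm hs).const_mul (1 - (x + y * Complex.I : ℂ) ^ 2)
  have hfun : (fun t => poissonKer x y t * u t) = fun t =>
      (((x + y * Complex.I : ℂ) * (Real.pi⁻¹ * (u t / (1 + t ^ 2)) : ℝ)) +
      (1 - (x + y * Complex.I : ℂ) ^ 2) * ((x + y * Complex.I - t * Complex.I : ℂ)⁻¹ *
        (Real.pi⁻¹ * (u t / (1 + t ^ 2)) : ℝ))).re :=
    funext fun t => (herglotz_kernel_re hx t (u t)).symm
  refine ⟨?_, ?_⟩
  · have h1 : poissonIntegral u x y = ∫ t, poissonKer x y t * u t := rfl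
    rw [h1, hfun, herglotz, cauchyTransform, ← integral_complex_ofReal, ← integral_const_mul,
      ← integral_const_mul, ← integral_add i1 i2]
    exact (integral_re (𝕜 := ℂ) (i1.add i2)).symm
  · rw [hfun]
    exact (i1.add i2).re

theorem tendsto_herglotz_zero {u : ℝ → ℝ} {v : ℕ → ℝ → ℝ}
    (hu : Integrable (fun t => u t / (1 + t ^ 2))) (hv : ∀ N, Integrable (fun t => v N t / (1 + t ^ 2)))
    (hle : ∀ N t, |v N t| ≤ u t) (hlim : ∀ t, Tendsto (fun N => v N t) atTop (𝓝 0)) {s : ℂ}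
    (hs : 0 < s.re) : Tendsto (fun N => herglotz (v N) s) atTop (𝓝 0) := by
  have hb : ∀ N t, ‖Real.pi⁻¹ * (v N t / (1 + t ^ 2))‖ ≤ Real.pi⁻¹ * (u t / (1 + t ^ 2)) := by
    intro N t
    have := Real.pi_pos
    rw [norm_mul, norm_div, Real.norm_of_nonneg (by positivity), Real.norm_of_nonneg
      (by positivity : 0 ≤ 1 + t ^ 2), Real.norm_eq_abs]
    gcongr
    exact hle N t
  have hl : ∀ t, Tendsto (fun N => Real.pi⁻¹ * (v N t / (1 + t ^ 2))) atTop (𝓝 0) := by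
    intro t
    simpa using ((hlim t).div_const (1 + t ^ 2)).const_mul Real.pi⁻¹
  have h1 : Tendsto (fun N => ∫ t, Real.pi⁻¹ * (v N t / (1 + t ^ 2))) atTop (𝓝 (∫ _ : ℝ, (0 : ℝ))) :=
    tendsto_integral_of_dominated_convergence _ (fun N => ((hv N).const_mul _).1)
      (hu.const_mul Real.pi⁻¹) (fun N => .of_forall (hb N)) (.of_forall hl)
  have h2 : Tendsto (fun N => cauchyTransform (fun t => Real.pi⁻¹ * (v N t / (1 + t ^ 2))) s) atTop
      (𝓝 (∫ _ : ℝ, (0 : ℂ))) := by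
    refine tendsto_integral_of_dominated_convergence
      (fun t => s.re⁻¹ * (Real.pi⁻¹ * (u t / (1 + t ^ 2))))
      (fun N => (integrable_cauchyTransform ((hv N).const_mul _) hs).1)
      ((hu.const_mul Real.pi⁻¹).const_mul _) (fun N => .of_forall fun t => ?_)
      (.of_forall fun t => ?_)
    · rw [norm_mul, Complex.norm_real]
      gcongr
      · exact norm_inv_sub_mul_I_le hs t
      · exact hb N t
    · have := (Complex.continuous_ofReal.tendsto 0).comp (hl t)
      simpa using this.const_mul (s - t * Complex.I)⁻¹
  simp only [integral_zero] at h1 h2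
  have h3 := (((Complex.continuous_ofReal.tendsto 0).comp h1).const_mul s).add
    (h2.const_mul (1 - s ^ 2))
  simpa [herglotz] using h3

/-- A function of the Smirnov class becomes bounded after multiplication with outer functions
of modulus at most `1` which are arbitrarily close to `1`. -/
theorem IsSmirnov.exists_outer {h : ℂ → ℂ} (hh : IsSmirnov h) : ∃ G : ℕ → ℂ → ℂ,
    (∀ N, DifferentiableOn ℂ (G N) {s : ℂ | 0 < s.re}) ∧
    (∀ N (s : ℂ), 0 < s.re → 0 ≤ (G N s).re) ∧
    (∀ N (s : ℂ), 0 < s.re → ‖h s * Complex.exp (-G N s)‖ ≤ Real.exp N) ∧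
    ∀ s : ℂ, 0 < s.re → Tendsto (fun N => G N s) atTop (𝓝 0) := by
  obtain ⟨-, u, hu0, hu, hmaj⟩ := hh
  -- Truncation: u ≤ v_N + N gives log⁺|h| ≤ P[v_N] + N, while 0 ≤ v_N ≤ u and v_N → 0 pointwise
  -- make the Herglotz integrals tend to zero.
  set v : ℕ → ℝ → ℝ := fun N t => max (u t - N) 0 with hv
  have hle : ∀ N t, |v N t| ≤ u t := by
    intro N t
    rw [abs_of_nonneg (le_max_right _ _)]
    exact max_le (by simp) (hu0 t)
  have hum : AEStronglyMeasurable u := by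
    have h1 : AEStronglyMeasurable (fun t => u t / (1 + t ^ 2) * (1 + t ^ 2)) :=
      hu.1.mul (by fun_prop : Continuous fun t : ℝ => 1 + t ^ 2).aestronglyMeasurable
    refine h1.congr (.of_forall fun t => ?_)
    have : (1 + t ^ 2) ≠ 0 := by positivity
    simp only
    field_simp
  have hvi : ∀ N, Integrable (fun t => v N t / (1 + t ^ 2)) := by
    intro N
    refine hu.mono' ?_ (.of_forall fun t => ?_)
    · have h2 : AEStronglyMeasurable (v N) :=
        ((hum.sub aestronglyMeasurable_const).sup aestronglyMeasurable_const)
      have h3 : Continuous (fun t : ℝ => (1 + t ^ 2)⁻¹) :=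
        Continuous.inv₀ (by fun_prop) fun t => by positivity
      simp_rw [div_eq_mul_inv]
      exact h2.mul h3.aestronglyMeasurable
    · rw [norm_div, Real.norm_of_nonneg (by positivity : 0 ≤ 1 + t ^ 2), Real.norm_eq_abs]
      gcongr
      exact hle N t
  refine ⟨fun N => herglotz (v N), fun N => differentiableOn_herglotz (hvi N), ?_, ?_, ?_⟩
  · intro N s hs
    have h1 := (re_herglotz (hvi N) hs s.im).1
    rw [Complex.re_add_im] at h1
    simp only [h1]
    exact integral_nonneg fun t => mul_nonneg (poissonKer_nonneg hs s.im t) (le_max_right _ _)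
  · intro N s hs
    obtain ⟨h1, i1⟩ := re_herglotz (hvi N) hs s.im
    obtain ⟨-, i2⟩ := re_herglotz hu hs s.im
    rw [Complex.re_add_im] at h1
    have h2 := hmaj s.re s.im hs
    rw [Complex.re_add_im] at h2
    have h3 : poissonIntegral u s.re s.im ≤ poissonIntegral (v N) s.re s.im + N := by
      have i3 := (integrable_poissonKer hs s.im).mul_const (N : ℝ)
      calc ∫ t, poissonKer s.re s.im t * u t
          ≤ ∫ t, (poissonKer s.re s.im t * v N t + poissonKer s.re s.im t * N) := by
            refine integral_mono i2 (i1.add i3) fun t => ?_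
            simp only
            rw [← mul_add]
            refine mul_le_mul_of_nonneg_left ?_ (poissonKer_nonneg hs s.im t)
            linarith [le_max_left (u t - N) 0]
        _ = _ := by
            rw [integral_add i1 i3, integral_mul_const, integral_poissonKer hs, one_mul]
            rfl
    have h4 : ‖h s‖ ≤ Real.exp (Real.posLog ‖h s‖) := by
      rcases eq_or_ne (h s) 0 with h0 | h0
      · simp [h0]
      · calc ‖h s‖ = Real.exp (Real.log ‖h s‖) := (Real.exp_log (norm_pos_iff.2 h0)).symm
          _ ≤ _ := Real.exp_le_exp.2 (le_max_right _ _)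
    rw [norm_mul, Complex.norm_exp, Complex.neg_re, h1]
    calc ‖h s‖ * Real.exp (-poissonIntegral (v N) s.re s.im)
        ≤ Real.exp (poissonIntegral (v N) s.re s.im + N) *
          Real.exp (-poissonIntegral (v N) s.re s.im) := by
          gcongr
          exact h4.trans (Real.exp_le_exp.2 (h2.trans h3))
      _ = Real.exp N := by
          rw [← Real.exp_add]
          congr 1
          ring
  · intro s hs
    refine tendsto_herglotz_zero hu hvi hle (fun t => ?_) hs
    refine tendsto_const_nhds.congr' ?_
    filter_upwards [eventually_ge_atTop ⌈u t⌉₊] with N hN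
    have : u t ≤ N := Nat.ceil_le.1 hN
    simp only [hv]
    rw [max_eq_right (by linarith)]

/-- The difference times the level-zero outer factors of both functions is bounded by 2 and vanishes
at every n + 1/2; the exponentials never vanish, so they can be cancelled again. -/
theorem IsAssociated.eqOn {c : ℕ → ℂ} {h₁ h₂ : ℂ → ℂ} (H₁ : IsAssociated c h₁)
    (H₂ : IsAssociated c h₂) : Set.EqOn h₁ h₂ {s : ℂ | 0 < s.re} := by
  obtain ⟨G₁, hd₁, hp₁, hb₁, -⟩ := H₁.smirnov.exists_outer
  obtain ⟨G₂, hd₂, hp₂, hb₂, -⟩ := H₂.smirnov.exists_outer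
  set f : ℂ → ℂ := fun s => (h₁ s - h₂ s) * Complex.exp (-G₁ 0 s) * Complex.exp (-G₂ 0 s) with hf
  have hfd : DifferentiableOn ℂ f {s : ℂ | 0 < s.re} :=
    ((H₁.smirnov.1.sub H₂.smirnov.1).mul (hd₁ 0).neg.cexp).mul (hd₂ 0).neg.cexp
  have hexp : ∀ {z : ℂ}, 0 ≤ z.re → ‖Complex.exp (-z)‖ ≤ 1 := by
    intro z hz
    rw [Complex.norm_exp]
    simpa using hz
  have hfM : ∀ s : ℂ, 0 < s.re → ‖f s‖ ≤ 2 := by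
    intro s hs
    have e : f s = h₁ s * Complex.exp (-G₁ 0 s) * Complex.exp (-G₂ 0 s)
        - h₂ s * Complex.exp (-G₂ 0 s) * Complex.exp (-G₁ 0 s) := by
      simp only [hf]
      ring
    have b₁ := hb₁ 0 s hs
    have b₂ := hb₂ 0 s hs
    simp only [Nat.cast_zero, Real.exp_zero] at b₁ b₂
    rw [e]
    refine (norm_sub_le _ _).trans ?_
    rw [norm_mul (h₁ s * Complex.exp (-G₁ 0 s)), norm_mul (h₂ s * Complex.exp (-G₂ 0 s))]
    linarith [mul_le_one₀ b₁ (norm_nonneg _) (hexp (hp₂ 0 s hs)),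
      mul_le_one₀ b₂ (norm_nonneg _) (hexp (hp₁ 0 s hs))]
  intro s hs
  have := eq_zero_of_bounded_of_zeros hfd hfM
    (fun n => by simp only [hf]; rw [H₁.interp, H₂.interp]; simp) hs
  simpa [hf, sub_eq_zero] using this

/-! ### Smirnov class membership of Mellin transforms times affine functions. -/

theorem integrable_sqrt_one_add_abs_div :
    Integrable (fun t : ℝ => √(1 + |t|) / (1 + t ^ 2)) := by
  have h1 : Integrable (fun t : ℝ => (1 + ‖t‖) ^ (-(3 / 2) : ℝ)) :=
    integrable_one_add_norm (by norm_num)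
  refine (h1.const_mul 2).mono' ?_ (.of_forall fun t => ?_)
  · exact (Continuous.div (by fun_prop) (by fun_prop) fun t => by positivity).aestronglyMeasurable
  · have hp : 0 < 1 + |t| := by positivity
    rw [Real.norm_of_nonneg (by positivity), Real.norm_eq_abs, div_le_iff₀ (by positivity),
      Real.sqrt_eq_rpow]
    have h2 : (1 + |t|) ^ (1 / 2 : ℝ) = (1 + |t|) ^ (-(3 / 2) : ℝ) * (1 + |t|) ^ 2 := by
      rw [← Real.rpow_natCast, ← Real.rpow_add hp]
      norm_num
    rw [h2, mul_comm 2, mul_assoc]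
    gcongr
    nlinarith [sq_abs t, sq_nonneg (1 - |t|)]

theorem integral_Ioi_poissonKer {x : ℝ} (hx : 0 < x) (y : ℝ) :
    ∫ t in Set.Ioi (y + x), poissonKer x y t = 1 / 4 := by
  have hd : ∀ t ∈ Set.Ici (y + x), HasDerivAt (fun t => Real.pi⁻¹ * Real.arctan ((t - y) / x))
      (poissonKer x y t) t := by
    intro t _
    have := ((((hasDerivAt_id t).sub_const y).div_const x).arctan).const_mul Real.pi⁻¹
    convert! this using 1
    unfold poissonKer
    have : 0 < x ^ 2 + (y - t) ^ 2 := by positivity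
    have : 0 < 1 + ((id t - y) / x) ^ 2 := by positivity
    simp only [id] at *
    field_simp
    ring
  have hlim : Tendsto (fun t => Real.pi⁻¹ * Real.arctan ((t - y) / x)) atTop
      (𝓝 (Real.pi⁻¹ * (Real.pi / 2))) := by
    refine Tendsto.const_mul _ ?_
    refine (Real.tendsto_arctan_atTop.mono_right nhdsWithin_le_nhds).comp ?_
    exact (tendsto_atTop_add_const_right _ _ tendsto_id).atTop_div_const hx
  rw [integral_Ioi_of_hasDerivAt_of_tendsto' hd (integrable_poissonKer hx y).integrableOn hlim,
    add_sub_cancel_left, div_self hx.ne', Real.arctan_one]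
  have := Real.pi_pos
  field_simp
  norm_num

theorem integral_poissonKer_mul_of_even {u : ℝ → ℝ} (hu : ∀ t, u (-t) = u t) (x y : ℝ) :
    ∫ t, poissonKer x y t * u t = ∫ t, poissonKer x |y| t * u t := by
  rcases abs_cases y with ⟨h, -⟩ | ⟨h, -⟩
  · rw [h]
  · rw [h, ← integral_neg_eq_self]
    congr 1
    ext t
    rw [hu]
    congr 1
    unfold poissonKer
    ring

/-- By symmetry y may be taken nonnegative. A quarter of the Poisson mass lies on t > y + x, where
|t| exceeds ‖s‖. The square root is a convenient majorant for the logarithm of an affine function,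
still integrable against 1/(1+t²). -/
theorem sqrt_one_add_norm_le_poisson {x : ℝ} (hx : 0 < x) (y : ℝ) :
    √(1 + ‖(x + y * Complex.I : ℂ)‖) ≤ 4 * ∫ t, poissonKer x y t * √(1 + |t|) := by
  rw [integral_poissonKer_mul_of_even (by simp)]
  have hi := (re_herglotz integrable_sqrt_one_add_abs_div hx |y|).2
  have hnorm : ‖(x + y * Complex.I : ℂ)‖ ≤ |y| + x := by
    refine (Complex.norm_le_abs_re_add_abs_im _).trans ?_
    simp [abs_of_pos hx, add_comm]
  have h1 : ∫ t in Set.Ioi (|y| + x), poissonKer x |y| t * √(1 + ‖(x + y * Complex.I : ℂ)‖)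
      ≤ ∫ t, poissonKer x |y| t * √(1 + |t|) := by
    refine le_trans ?_ (setIntegral_le_integral (s := Set.Ioi (|y| + x)) hi
      (.of_forall fun t => mul_nonneg (poissonKer_nonneg hx _ t) (Real.sqrt_nonneg _)))
    refine setIntegral_mono_on ((integrable_poissonKer hx _).mul_const _).integrableOn
      hi.integrableOn measurableSet_Ioi fun t ht => ?_
    refine mul_le_mul_of_nonneg_left (Real.sqrt_le_sqrt ?_) (poissonKer_nonneg hx _ t)
    have ht : |y| + x < t := ht
    linarith [le_abs_self t]
  rw [integral_mul_const, integral_Ioi_poissonKer hx] at h1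
  linarith

theorem posLog_le_self {r : ℝ} (hr : 0 ≤ r) : Real.posLog r ≤ r :=
  max_le hr (Real.log_le_self hr)

theorem posLog_norm_affine_le (a : ℝ) (d s : ℂ) :
    Real.posLog ‖a * s + d‖ ≤ (3 + |a| + ‖d‖) * √(1 + ‖s‖) := by
  have h1 : ‖a * s + d‖ ≤ (1 + |a| + ‖d‖) * (1 + ‖s‖) := by
    refine (norm_add_le _ _).trans ?_
    rw [norm_mul, Complex.norm_real, Real.norm_eq_abs]
    nlinarith [norm_nonneg s, norm_nonneg d, abs_nonneg a, mul_nonneg (norm_nonneg s) (norm_nonneg d)]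
  have h2 : 1 ≤ √(1 + ‖s‖) := by
    rw [Real.one_le_sqrt]
    linarith [norm_nonneg s]
  have h3 : Real.posLog (1 + ‖s‖) ≤ 2 * √(1 + ‖s‖) := by
    refine max_le (by positivity) ?_
    have := Real.log_le_self (Real.sqrt_nonneg (1 + ‖s‖))
    rw [Real.log_sqrt (by positivity)] at this
    linarith
  have h4 : Real.posLog (1 + |a| + ‖d‖) ≤ 1 + |a| + ‖d‖ := posLog_le_self (by positivity)
  calc Real.posLog ‖a * s + d‖ ≤ Real.posLog ((1 + |a| + ‖d‖) * (1 + ‖s‖)) :=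
        Real.posLog_le_posLog (norm_nonneg _) h1
    _ ≤ Real.posLog (1 + |a| + ‖d‖) + Real.posLog (1 + ‖s‖) := Real.posLog_mul
    _ ≤ (1 + |a| + ‖d‖) * √(1 + ‖s‖) + 2 * √(1 + ‖s‖) := by
        refine add_le_add (h4.trans ?_) h3
        exact le_mul_of_one_le_right (by positivity) h2
    _ = _ := by ring

/-- The product of a Mellin transform of an `L²` function and an affine function belongs to the
Smirnov class. -/
theorem isSmirnov_mell_mul_affine (f : L2) (a : ℝ) (d : ℂ) :
    IsSmirnov (fun s => mell f s * (a * s + d)) := by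
  refine ⟨(differentiableOn_mell f).mul (by fun_prop), ?_⟩
  set K : ℝ := 4 * (3 + |a| + ‖d‖) with hK
  have i1 : Integrable (fun t => ‖bdry f t‖ / (1 + t ^ 2)) := by
    have := ((integrable_poissonKer_mul one_pos 0 (memLp_bdry f)).norm).const_mul Real.pi
    refine this.congr (.of_forall fun t => ?_)
    simp only [norm_mul, Complex.norm_real, Real.norm_of_nonneg (poissonKer_nonneg one_pos 0 t)]
    unfold poissonKer
    have := Real.pi_pos
    field_simp
    ring
  have i2 := integrable_sqrt_one_add_abs_div.const_mul K
  -- The Mellin factor is handled by log⁺ r ≤ r and its Poisson representation, the affine factor by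
  -- the square-root majorant.
  refine ⟨fun t => ‖bdry f t‖ + K * √(1 + |t|), fun t => by positivity, ?_, ?_⟩
  · refine (i1.add i2).congr (.of_forall fun t => ?_)
    simp only [Pi.add_apply]
    ring
  · intro x y hx
    set s : ℂ := x + y * Complex.I with hs
    have j1 := (integrable_poissonKer_mul hx y (memLp_bdry f)).norm
    have j2 := (re_herglotz integrable_sqrt_one_add_abs_div hx y).2
    have e1 : Real.posLog ‖mell f s‖ ≤ ∫ t, ‖(poissonKer x y t : ℂ) * bdry f t‖ := by
      refine (posLog_le_self (norm_nonneg _)).trans ?_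
      rw [hs, mell_eq_poisson f hx]
      exact norm_integral_le_integral_norm _
    have e2 : Real.posLog ‖a * s + d‖ ≤ K * ∫ t, poissonKer x y t * √(1 + |t|) := by
      refine (posLog_norm_affine_le a d s).trans ?_
      rw [hK, mul_comm 4, mul_assoc]
      gcongr
      exact sqrt_one_add_norm_le_poisson hx y
    rw [norm_mul]
    refine Real.posLog_mul.trans ((add_le_add e1 e2).trans (le_of_eq ?_))
    rw [← integral_const_mul, ← integral_add j1 (j2.const_mul K)]
    refine integral_congr_ae (.of_forall fun t => ?_)
    simp only [norm_mul, Complex.norm_real, Real.norm_of_nonneg (poissonKer_nonneg hx y t)]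
    unfold poissonKer
    ring

/-! ### Existence of `h` and necessity of the local L² condition. -/

theorem norm_monomial_sq (p : ℂ) (hp : -1 / 2 < p.re) :
    ‖monomial p hp‖ ^ 2 = 1 / (2 * p.re + 1) := by
  have h : inner ℂ (monomial p hp) (monomial p hp) = ((1 / (2 * p.re + 1) : ℝ) : ℂ) := by
    rw [inner_monomial, mell_monomial p hp (by simp; linarith)]
    have : starRingEnd ℂ p + 1 / 2 + p + 1 / 2 = ((2 * p.re + 1 : ℝ) : ℂ) := by
      have := Complex.add_conj p
      push_cast
      push_cast at this
      rw [← this]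
      ring
    rw [this]
    push_cast
    rfl
  rw [← inner_self_eq_norm_sq (𝕜 := ℂ), h]
  exact Complex.ofReal_re _

section Necessity

variable {a b : ℝ} {c p : ℕ → ℂ} {hp : ∀ n, -1 / 2 < (p n).re}

/-- The image under the adjoint of a bounded monomial operator of a reproducing kernel yields the
associated interpolating function. -/
theorem isAssociated_adjoint (hpn : ∀ n : ℕ, p n = a * n + b)
    {T : L2 →L[ℂ] L2} (hT : ∀ n : ℕ, T (monomial n (natCast_re n)) = c n • monomial (p n) (hp n))
    (q : ℂ) (hq : -1 / 2 < q.re) :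
    IsAssociated c (fun s => mell (ContinuousLinearMap.adjoint T (monomial q hq)) s *
      (a * s + ((b + (1 - a) / 2 : ℝ) + (q + 1 / 2)))) := by
  refine ⟨isSmirnov_mell_mul_affine _ a _, fun n => ?_⟩
  have hpr : starRingEnd ℂ (p n) = p n := by
    rw [hpn]
    simp
  have hpos : 0 < (p n + 1 / 2).re := by
    have := hp n
    simp
    linarith
  have h1 : mell (ContinuousLinearMap.adjoint T (monomial q hq)) (n + 1 / 2)
      = starRingEnd ℂ (c n) * (1 / (p n + 1 / 2 + q + 1 / 2)) := by
    have := inner_monomial n (natCast_re n) (ContinuousLinearMap.adjoint T (monomial q hq))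
    rw [Complex.conj_natCast] at this
    rw [← this, ContinuousLinearMap.adjoint_inner_right, hT, inner_smul_left, inner_monomial, hpr,
      mell_monomial q hq hpos]
  have hne : p n + 1 / 2 + q + 1 / 2 ≠ 0 := by
    intro h
    have := congrArg Complex.re h
    simp at this hpos
    linarith
  have h2 : (a * (n + 1 / 2) + ((b + (1 - a) / 2 : ℝ) + (q + 1 / 2)) : ℂ)
      = p n + 1 / 2 + q + 1 / 2 := by
    rw [hpn]
    push_cast
    ring
  rw [h1, h2, mul_assoc, one_div_mul_cancel hne, mul_one]

theorem IsBounded.exists_isAssociated (hpn : ∀ n : ℕ, p n = a * n + b)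
    (hT : IsBounded c p hp) : ∃ h : ℂ → ℂ, IsAssociated c h := by
  obtain ⟨T, hT⟩ := hT
  exact ⟨_, isAssociated_adjoint hpn hT 0 (by norm_num)⟩

/-- Uniqueness identifies the functions built from all kernels x^q, so the formula for the boundary
function may be chosen anew in each window. -/
theorem IsBounded.uniformlyLocallyL2 (ha : 0 < a) (hb : 0 < b + (1 - a) / 2)
    (hpn : ∀ n : ℕ, p n = a * n + b) (hT : IsBounded c p hp) {h : ℂ → ℂ} (hh : IsAssociated c h) :
    UniformlyLocallyL2 h := by
  obtain ⟨T, hT⟩ := hT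
  set S := ContinuousLinearMap.adjoint T with hS
  set β : ℝ := b + (1 - a) / 2 with hβ
  have hbd : ∀ (q : ℂ) (hq : -1 / 2 < q.re), ∀ᵐ y : ℝ,
      Tendsto (fun x : ℝ => h (x + y * Complex.I)) (𝓝[>] 0)
        (𝓝 (bdry (S (monomial q hq)) y * (a * (y * Complex.I) + (β + (q + 1 / 2))))) := by
    intro q hq
    filter_upwards [ae_tendsto_mell (S (monomial q hq))] with y hy
    have h1 : Tendsto (fun x : ℝ => (a * (x + y * Complex.I) + (β + (q + 1 / 2)) : ℂ)) (𝓝[>] 0)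
        (𝓝 (a * ((0 : ℝ) + y * Complex.I) + (β + (q + 1 / 2)))) :=
      ((by fun_prop : Continuous (fun x : ℝ =>
        (a * (x + y * Complex.I) + (β + (q + 1 / 2)) : ℂ))).tendsto 0).mono_left nhdsWithin_le_nhds
    rw [Complex.ofReal_zero, zero_add] at h1
    refine (hy.mul h1).congr' ?_
    filter_upwards [self_mem_nhdsWithin] with x hx
    have hx : 0 < x := hx
    exact (isAssociated_adjoint hpn hT q hq).eqOn hh
      (show 0 < (x + y * Complex.I : ℂ).re by simpa using hx)
  refine ⟨_, hbd 0 (by norm_num), ?_⟩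
  set g : ℝ → ℂ := fun y => bdry (S (monomial 0 (by norm_num))) y *
    (a * (y * Complex.I) + (β + (0 + 1 / 2))) with hg
  set K : ℝ := β + 1 / 2 + a with hK
  have hKpos : 0 ≤ K := by positivity
  refine lt_of_le_of_lt (iSup_le (a := ENNReal.ofReal K ^ 2 *
    (ENNReal.ofReal (2 * Real.pi) * ENNReal.ofReal ‖S‖ ^ 2)) fun τ => ?_) ?_
  -- The imaginary exponent moves the affine factor to β + 1/2 + ia(y - τ), at most `K` in norm on
  -- the window, and keeps ‖x^q‖ = 1.
  · set q : ℂ := ((-(a * τ) : ℝ) : ℂ) * Complex.I with hq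
    have hqre : -1 / 2 < q.re := by
      rw [hq, Complex.re_ofReal_mul, Complex.I_re]
      norm_num
    have hae : ∀ᵐ y : ℝ, g y = bdry (S (monomial q hqre)) y *
        (a * (y * Complex.I) + (β + (q + 1 / 2))) := by
      filter_upwards [hbd 0 (by norm_num), hbd q hqre] with y h1 h2
      exact tendsto_nhds_unique h1 h2
    calc ∫⁻ y in Set.Icc τ (τ + 1), ‖g y‖ₑ ^ 2
        ≤ ∫⁻ y in Set.Icc τ (τ + 1),
            ENNReal.ofReal K ^ 2 * ‖bdry (S (monomial q hqre)) y‖ₑ ^ 2 := by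
          refine lintegral_mono_ae ?_
          filter_upwards [ae_restrict_of_ae hae, ae_restrict_mem measurableSet_Icc] with y hy hy'
          rw [hy, enorm_mul, mul_pow, mul_comm]
          gcongr
          rw [← ofReal_norm]
          refine ENNReal.ofReal_le_ofReal ?_
          have e : (a * (y * Complex.I) + (β + (q + 1 / 2)) : ℂ)
              = ((β + 1 / 2 : ℝ) : ℂ) + ((a * (y - τ) : ℝ) : ℂ) * Complex.I := by
            rw [hq]
            push_cast
            ring
          rw [e]
          refine (norm_add_le _ _).trans ?_
          rw [norm_mul, Complex.norm_real, Complex.norm_real, Complex.norm_I, mul_one,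
            Real.norm_of_nonneg (by positivity),
            Real.norm_of_nonneg (mul_nonneg ha.le (by linarith [hy'.1]))]
          have : a * (y - τ) ≤ a * 1 := by
            gcongr
            linarith [hy'.2]
          linarith
      _ ≤ ∫⁻ y, ENNReal.ofReal K ^ 2 * ‖bdry (S (monomial q hqre)) y‖ₑ ^ 2 :=
          setLIntegral_le_lintegral _ _
      _ = ENNReal.ofReal K ^ 2 * (ENNReal.ofReal (2 * Real.pi) * ‖S (monomial q hqre)‖ₑ ^ 2) := by
          rw [lintegral_const_mul', lintegral_bdry_sq]
          simp
      _ ≤ _ := by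
          gcongr
          rw [← ofReal_norm]
          refine ENNReal.ofReal_le_ofReal ?_
          refine S.le_of_opNorm_le le_rfl _ |>.trans ?_
          refine mul_le_of_le_one_right (norm_nonneg _) ?_
          have h0 : q.re = 0 := by
            rw [hq, Complex.re_ofReal_mul, Complex.I_re, mul_zero]
          have := norm_monomial_sq q hqre
          rw [h0] at this
          nlinarith [norm_nonneg (monomial q hqre)]
  · exact ENNReal.mul_lt_top (by simp) (ENNReal.mul_lt_top ENNReal.ofReal_lt_top (by simp))

end Necessity

/-! ### Density of the polynomials. -/

theorem mell_eq_inner (f : L2) {s : ℂ} (hs : 0 < s.re) :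
    mell f s = inner ℂ (monomial (starRingEnd ℂ s - 1 / 2) (by simp; linarith)) f := by
  rw [inner_monomial]
  congr 1
  simp [map_ofNat]

/-- A Mellin transform need not be bounded up to the imaginary axis, but it is bounded on Re s > 1.
The unit shift sends the interpolation points n + 3/2 back to n + 1/2, so the zero theorem for
bounded functions still applies. -/
theorem exists_norm_mell_add_one_le (f : L2) :
    ∃ M, ∀ s : ℂ, 0 < s.re → ‖mell f (s + 1)‖ ≤ M := by
  refine ⟨∫ u, Real.exp (-1 * |u|) * ‖lift f u‖, fun s hs => ?_⟩
  rw [mell_eq_integral]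
  refine norm_integral_le_of_norm_le
    ((memLp_exp_neg_mul_abs one_pos).integrable_mul (memLp_lift f).norm) (.of_forall fun u => ?_)
  rcases le_or_gt u 0 with hu | hu
  · simp [lift_of_nonpos f hu]
  · rw [norm_mul, Complex.norm_exp, abs_of_pos hu]
    gcongr
    simp
    nlinarith

/-- The linear combinations of the monomials. -/
def polyMap : (ℕ →₀ ℂ) →ₗ[ℂ] L2 :=
  Finsupp.linearCombination ℂ (fun n : ℕ => monomial n (natCast_re n))

theorem denseRange_polyMap : DenseRange polyMap := by
  have h1 : (LinearMap.range polyMap).topologicalClosure = ⊤ := by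
    rw [Submodule.topologicalClosure_eq_top_iff, Submodule.eq_bot_iff]
    intro f hf
    have h0 : ∀ n : ℕ, mell f (n + 1 / 2) = 0 := by
      intro n
      have h2 := (Submodule.mem_orthogonal _ f).1 hf (monomial n (natCast_re n))
        ⟨Finsupp.single n 1, by simp [polyMap]⟩
      rwa [inner_monomial, Complex.conj_natCast] at h2
    obtain ⟨M, hM⟩ := exists_norm_mell_add_one_le f
    -- Vanishing is known for s ↦ `mell f (s + 1)` on Re s > 0, so any abscissa above 1 serves.
    refine eq_zero_of_mell_eq_zero (x := 2) two_pos fun y => ?_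
    have h3 := eq_zero_of_bounded_of_zeros (f := fun s => mell f (s + 1)) (M := M)
      ((differentiableOn_mell f).comp (by fun_prop) fun s hs => ?_) hM (fun n => ?_)
      (s := 1 + y * Complex.I) (by simp)
    · rw [← h3]
      congr 1
      push_cast
      ring
    · have hs : 0 < s.re := hs
      simp only [Set.mem_ofPred_eq, Complex.add_re, Complex.one_re]
      linarith
    · rw [← h0 (n + 1)]
      congr 1
      push_cast
      ring
  have h2 := congrArg (fun K : Submodule ℂ L2 => (K : Set L2)) h1
  simp only [Submodule.topologicalClosure_coe, Submodule.top_coe] at h2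
  rw [DenseRange, dense_iff_closure_eq]
  exact h2

theorem mell_polyMap (α : ℕ →₀ ℂ) {s : ℂ} (hs : 0 < s.re) :
    mell (polyMap α) s = α.sum fun n z => z * (s + n + 1 / 2)⁻¹ := by
  rw [mell_eq_inner _ hs, polyMap, Finsupp.linearCombination_apply, Finsupp.sum, inner_sum]
  refine Finset.sum_congr rfl fun n _ => ?_
  rw [inner_smul_right, ← mell_eq_inner _ hs, mell_monomial _ _ hs, one_div]

/-! ### Cauchy's formula on vertical lines -/

/-- Cauchy's theorem on the rectangle [ε, R] × [-R, R]: quadratic decay makes the other three sides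
O(1/R). -/
theorem integral_vertical_eq_zero {Q : ℂ → ℂ} {C R₀ ε : ℝ} (hε : 0 < ε)
    (hQ : DifferentiableOn ℂ Q {s : ℂ | 0 < s.re})
    (hC : ∀ s : ℂ, 0 < s.re → R₀ ≤ ‖s‖ → ‖Q s‖ ≤ C / ‖s‖ ^ 2)
    (hi : Integrable (fun y : ℝ => Q (ε + y * Complex.I))) :
    ∫ y : ℝ, Q (ε + y * Complex.I) = 0 := by
  have hlim := intervalIntegral_tendsto_integral hi tendsto_neg_atTop_atBot tendsto_id
  refine tendsto_nhds_unique hlim ?_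
  have hz : Tendsto (fun R : ℝ => |C| * 4 / R) atTop (𝓝 0) :=
    tendsto_const_nhds.div_atTop tendsto_id
  refine squeeze_zero_norm' ?_ hz
  filter_upwards [eventually_ge_atTop R₀, eventually_gt_atTop ε] with R hR hRε
  have hR0 : 0 < R := hε.trans hRε
  have hb : ∀ s : ℂ, 0 < s.re → R ≤ ‖s‖ → ‖Q s‖ ≤ |C| / R ^ 2 := by
    intro s hs hRs
    refine (hC s hs (hR.trans hRs)).trans ?_
    calc C / ‖s‖ ^ 2 ≤ |C| / ‖s‖ ^ 2 := by gcongr; exact le_abs_self C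
      _ ≤ |C| / R ^ 2 := by gcongr
  have key := Complex.integral_boundary_rect_eq_zero_of_differentiableOn Q
    (ε + (-R : ℝ) * Complex.I) (R + R * Complex.I) (hQ.mono fun s hs => ?_)
  · simp only [Complex.add_re, Complex.ofReal_re, Complex.mul_re, Complex.I_re, mul_zero,
      Complex.ofReal_im, Complex.I_im, mul_one, sub_self, add_zero, Complex.add_im, Complex.mul_im,
      zero_add] at key
    set A := ∫ x in ε..R, Q (x + (-R : ℝ) * Complex.I)
    set B := ∫ x in ε..R, Q (x + R * Complex.I)
    set D := ∫ y in (-R)..R, Q (R + y * Complex.I)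
    set E := ∫ y in (-R)..R, Q (ε + y * Complex.I)
    have hE : E = -Complex.I * (A - B) + D := by
      have : Complex.I • E = A - B + Complex.I • D := by
        linear_combination -key
      simp only [smul_eq_mul] at this
      linear_combination (-Complex.I) * this + (E - D) * Complex.I_sq
    have hA : ‖A‖ ≤ |C| / R ^ 2 * |R - ε| := by
      refine intervalIntegral.norm_integral_le_of_norm_le_const fun x hx => ?_
      rw [Set.uIoc_of_le hRε.le] at hx
      refine hb _ (by simpa using hε.trans hx.1) ?_
      refine le_trans ?_ (Complex.abs_im_le_norm _)
      simp [abs_of_pos hR0]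
    have hB : ‖B‖ ≤ |C| / R ^ 2 * |R - ε| := by
      refine intervalIntegral.norm_integral_le_of_norm_le_const fun x hx => ?_
      rw [Set.uIoc_of_le hRε.le] at hx
      refine hb _ (by simpa using hε.trans hx.1) ?_
      refine le_trans ?_ (Complex.abs_im_le_norm _)
      simp [abs_of_pos hR0]
    have hD : ‖D‖ ≤ |C| / R ^ 2 * |R - -R| := by
      refine intervalIntegral.norm_integral_le_of_norm_le_const fun x hx => ?_
      refine hb _ (by simpa using hR0) ?_
      refine le_trans ?_ (Complex.abs_re_le_norm _)
      simp [abs_of_pos hR0]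
    have h1 : |R - ε| ≤ R := by rw [abs_of_pos (by linarith)]; linarith
    have h2 : |R - -R| = 2 * R := by rw [abs_of_pos (by linarith)]; ring
    rw [h2] at hD
    have h3 : |C| / R ^ 2 * |R - ε| ≤ |C| / R ^ 2 * R := by gcongr
    change ‖E‖ ≤ _
    calc ‖E‖ ≤ ‖A‖ + ‖B‖ + ‖D‖ := by
          rw [hE]
          refine (norm_add_le _ _).trans ?_
          gcongr
          rw [norm_mul, norm_neg, Complex.norm_I, one_mul]
          exact norm_sub_le _ _
      _ ≤ |C| / R ^ 2 * R + |C| / R ^ 2 * R + |C| / R ^ 2 * (2 * R) := by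
          gcongr
          · exact hA.trans h3
          · exact hB.trans h3
      _ = |C| * 4 / R := by
          field_simp
          ring
  · have h1 := (Complex.mem_reProdIm.1 hs).1
    simp only [Complex.add_re, Complex.ofReal_re, Complex.mul_re, Complex.I_re, mul_zero,
      Complex.ofReal_im, Complex.I_im, mul_one, sub_self, add_zero] at h1
    rw [Set.uIcc_of_le hRε.le] at h1
    exact hε.trans_le h1.1

theorem min_mul_norm_add_one_le {a d : ℝ} (ha : 0 < a) (hd : 0 < d) {s : ℂ} (hs : 0 ≤ s.re) :
    min a d * ‖s + 1‖ ≤ ‖a * s + d‖ := by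
  have hm : 0 < min a d := lt_min ha hd
  refine abs_le_of_sq_le_sq' ?_ (norm_nonneg _) |>.2
  rw [mul_pow, ← Complex.normSq_eq_norm_sq, ← Complex.normSq_eq_norm_sq, Complex.normSq_apply,
    Complex.normSq_apply]
  simp
  have h1 : min a d * (s.re + 1) ≤ a * s.re + d := by
    nlinarith [min_le_left a d, min_le_right a d]
  have h2 : (min a d * (s.re + 1)) ^ 2 ≤ (a * s.re + d) ^ 2 := by gcongr
  have h3 : min a d ^ 2 * (s.im * s.im) ≤ a ^ 2 * (s.im * s.im) := by
    gcongr
    · exact mul_self_nonneg _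
    · exact min_le_left _ _
  nlinarith

theorem norm_inv_affine_le {a d : ℝ} (ha : 0 < a) (hd : 0 < d) {s : ℂ} (hs : 0 ≤ s.re) :
    ‖(a * s + d : ℂ)⁻¹‖ ≤ (min a d)⁻¹ * ‖s + 1‖⁻¹ := by
  have hm : 0 < min a d := lt_min ha hd
  have h1 : s + 1 ≠ 0 := fun h => by
    have := congrArg Complex.re h
    simp at this
    linarith
  rw [norm_inv, ← mul_inv]
  exact inv_anti₀ (by positivity) (min_mul_norm_add_one_le ha hd hs)

/-- `(1 + y ^ 2) ^ (-1/2)`. -/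
def japanese (y : ℝ) : ℝ := (√(1 + y ^ 2))⁻¹

theorem japanese_nonneg (y : ℝ) : 0 ≤ japanese y := inv_nonneg.2 (Real.sqrt_nonneg _)

theorem japanese_mul_self (y : ℝ) : japanese y * japanese y = (1 + y ^ 2)⁻¹ := by
  rw [japanese, ← mul_inv, Real.mul_self_sqrt (by positivity)]

theorem inv_norm_le_japanese {x : ℝ} (hx : 0 ≤ x) (y : ℝ) :
    ‖(x + y * Complex.I + 1 : ℂ)‖⁻¹ ≤ japanese y := by
  refine inv_anti₀ (by positivity) (Real.sqrt_le_iff.2 ⟨norm_nonneg _, ?_⟩)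
  rw [← Complex.normSq_eq_norm_sq, Complex.normSq_apply]
  simp
  nlinarith

theorem norm_inv_add_mul_I_le {d : ℝ} (hd : 0 < d) (y : ℝ) :
    ‖(d + y * Complex.I : ℂ)⁻¹‖ ≤ (min 1 d)⁻¹ * japanese y := by
  have hm : 0 < min 1 d := lt_min one_pos hd
  have h1 := norm_inv_affine_le one_pos hd (s := y * Complex.I) (by simp)
  have h2 := inv_norm_le_japanese le_rfl y
  rw [Complex.ofReal_one, one_mul, add_comm] at h1
  rw [Complex.ofReal_zero, zero_add] at h2
  refine h1.trans ?_
  gcongr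

theorem norm_inv_sub_mul_I_le' {d : ℝ} (hd : 0 < d) (y : ℝ) :
    ‖(d - y * Complex.I : ℂ)⁻¹‖ ≤ (min 1 d)⁻¹ * japanese y := by
  have := norm_inv_add_mul_I_le hd (-y)
  rwa [Complex.ofReal_neg, neg_mul, ← sub_eq_add_neg, japanese, neg_sq] at this

theorem integrable_of_norm_le_japanese {f : ℝ → ℂ} (hf : Continuous f) {C : ℝ}
    (h : ∀ y, ‖f y‖ ≤ C * (japanese y * japanese y)) : Integrable f := by
  refine (integrable_inv_one_add_sq.const_mul C).mono' hf.aestronglyMeasurable (.of_forall fun y => ?_)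
  rw [← japanese_mul_self]
  exact h y

/-- Partial fractions give (1/(r+iy) + 1/(q-iy))/(r+q). The two terms are not separately integrable,
but their real parts are multiples of Poisson kernels; the integral is real by the symmetry y ↦ -y.
-/
theorem integral_inv_mul_inv {r q : ℝ} (hr : 0 < r) (hq : 0 < q) :
    ∫ y : ℝ, (r + y * Complex.I : ℂ)⁻¹ * (q - y * Complex.I : ℂ)⁻¹ = 2 * Real.pi / (r + q) := by
  have hr0 : ∀ y : ℝ, (r + y * Complex.I : ℂ) ≠ 0 := fun y h => by
    have := congrArg Complex.re h
    simp at this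
    exact hr.ne' this
  have hq0 : ∀ y : ℝ, (q - y * Complex.I : ℂ) ≠ 0 := fun y h => by
    have := congrArg Complex.re h
    simp at this
    exact hq.ne' this
  set f : ℝ → ℂ := fun y => (r + y * Complex.I : ℂ)⁻¹ * (q - y * Complex.I : ℂ)⁻¹ with hf
  have hc : Continuous f :=
    (Continuous.inv₀ (by fun_prop) hr0).mul (Continuous.inv₀ (by fun_prop) hq0)
  have hm1 : 0 < min 1 r := lt_min one_pos hr
  have hm2 : 0 < min 1 q := lt_min one_pos hq
  have hi : Integrable f := by
    refine integrable_of_norm_le_japanese hc (C := (min 1 r)⁻¹ * (min 1 q)⁻¹) fun y => ?_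
    rw [hf, norm_mul, mul_mul_mul_comm]
    have := japanese_nonneg y
    gcongr
    · exact norm_inv_add_mul_I_le hr y
    · exact norm_inv_sub_mul_I_le' hq y
  have hconj : starRingEnd ℂ (∫ y, f y) = ∫ y, f y := by
    rw [← integral_conj, ← integral_neg_eq_self]
    congr 1
    ext y
    simp only [hf, map_mul, map_inv₀, map_add, map_sub, Complex.conj_ofReal, Complex.conj_I]
    push_cast
    congr 2 <;> ring
  have hre : ∀ y, (f y).re = Real.pi / (r + q) * (poissonKer r 0 y + poissonKer q 0 y) := by
    intro y
    have e : f y = (((r + q)⁻¹ : ℝ) : ℂ) * ((r + y * Complex.I : ℂ)⁻¹ + (q - y * Complex.I : ℂ)⁻¹) := by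
      have h0 : (r + q : ℂ) ≠ 0 := by exact_mod_cast (add_pos hr hq).ne'
      have h1 := hr0 y
      have h2 := hq0 y
      simp only [hf]
      push_cast
      field_simp
      ring
    rw [e, Complex.re_ofReal_mul]
    have p1 : 0 < r ^ 2 + y ^ 2 := by positivity
    have p2 : 0 < q ^ 2 + y ^ 2 := by positivity
    have := Real.pi_pos
    simp [Complex.inv_re, Complex.normSq_apply, poissonKer, ← pow_two]
    field_simp
  have hval : (∫ y, f y).re = 2 * Real.pi / (r + q) := by
    have h1 : (∫ y, f y).re = ∫ y, (f y).re := (integral_re (𝕜 := ℂ) hi).symm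
    rw [h1]
    simp_rw [hre]
    rw [integral_const_mul, integral_add (integrable_poissonKer hr 0) (integrable_poissonKer hq 0),
      integral_poissonKer hr, integral_poissonKer hq]
    ring
  rw [← Complex.conj_eq_iff_re.1 hconj, hval]
  push_cast
  rfl

theorem integrable_cauchy {W : ℂ → ℂ} {C ε l : ℝ} (hε : 0 < ε) (hl : ε < l)
    (hW : DifferentiableOn ℂ W {s : ℂ | 0 < s.re}) (hC : ∀ s : ℂ, 0 < s.re → ‖W s‖ ≤ C * ‖s + 1‖⁻¹) :
    Integrable (fun y : ℝ => W (ε + y * Complex.I) * (((l - ε : ℝ) : ℂ) - y * Complex.I)⁻¹) := by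
  have hle : 0 < l - ε := sub_pos.2 hl
  have hm : 0 < min 1 (l - ε) := lt_min one_pos hle
  have hC0 : 0 ≤ C := by
    have h1 := (norm_nonneg _).trans (hC 1 (by simp))
    exact nonneg_of_mul_nonneg_left h1 (by norm_num)
  have hpos : ∀ y : ℝ, 0 < (ε + y * Complex.I : ℂ).re := fun y => by simpa using hε
  have hcomp : Continuous (fun y : ℝ => W (ε + y * Complex.I)) :=
    hW.continuousOn.comp_continuous (by fun_prop) hpos
  have hker : Continuous (fun y : ℝ => (((l - ε : ℝ) : ℂ) - y * Complex.I)⁻¹) := by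
    refine Continuous.inv₀ (by fun_prop) fun y h => ?_
    have := congrArg Complex.re h
    simp at this
    linarith
  refine integrable_of_norm_le_japanese (hcomp.mul hker) (C := C * (min 1 (l - ε))⁻¹) fun y => ?_
  rw [norm_mul, mul_mul_mul_comm]
  have := japanese_nonneg y
  refine mul_le_mul ((hC _ (hpos y)).trans ?_) (norm_inv_sub_mul_I_le' hle y) (norm_nonneg _)
    (by positivity)
  exact mul_le_mul_of_nonneg_left (inv_norm_le_japanese hε.le y) hC0

/-- Cauchy's formula in the right half-plane. -/
theorem integral_cauchy {W : ℂ → ℂ} {C ε l : ℝ} (hε : 0 < ε) (hl : ε < l)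
    (hW : DifferentiableOn ℂ W {s : ℂ | 0 < s.re}) (hC : ∀ s : ℂ, 0 < s.re → ‖W s‖ ≤ C * ‖s + 1‖⁻¹) :
    ∫ y : ℝ, W (ε + y * Complex.I) * (((l - ε : ℝ) : ℂ) - y * Complex.I)⁻¹ = 2 * Real.pi * W l := by
  have hl0 : 0 < l := hε.trans hl
  have hle : 0 < l - ε := sub_pos.2 hl
  have hs1 : ∀ s : ℂ, 0 < s.re → s + 1 ≠ 0 := fun s hs => by
    simpa using add_ofReal_ne_zero hs one_pos
  -- Subtracting a multiple of 1/(s+1) makes `V` vanish at l, so V/(s - l) is holomorphic with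
  -- quadratic decay and integrates to zero. The subtracted term is evaluated by
  -- `integral_inv_mul_inv`.
  set V : ℂ → ℂ := fun s => W s - W l * (l + 1) * (s + 1)⁻¹ with hV
  have hVd : DifferentiableOn ℂ V {s : ℂ | 0 < s.re} :=
    hW.sub (DifferentiableOn.const_mul (DifferentiableOn.inv (by fun_prop) fun s hs => hs1 s hs) _)
  have hl1 : (l + 1 : ℂ) ≠ 0 := hs1 l (by simpa using hl0)
  have hVl : V l = 0 := by
    simp only [hV]
    field_simp
    ring
  set C' := C + ‖W l * (l + 1)‖ with hC'
  have hVC : ∀ s : ℂ, 0 < s.re → ‖V s‖ ≤ C' * ‖s + 1‖⁻¹ := by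
    intro s hs
    refine (norm_sub_le _ _).trans ?_
    rw [hC', add_mul, norm_mul _ (s + 1)⁻¹, norm_inv]
    gcongr
    exact hC s hs
  have hC'0 : 0 ≤ C' := by
    have h1 := (norm_nonneg _).trans (hVC 1 (by simp))
    exact nonneg_of_mul_nonneg_left h1 (by norm_num)
  have hmem : {s : ℂ | 0 < s.re} ∈ 𝓝 (l : ℂ) :=
    isOpen_rightHalfPlane.mem_nhds (by simpa using hl0)
  have hQd : DifferentiableOn ℂ (dslope V l) {s : ℂ | 0 < s.re} :=
    (Complex.differentiableOn_dslope hmem).2 hVd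
  have hQ : ∀ s : ℂ, s ≠ l → dslope V l s = V s * (s - l)⁻¹ := by
    intro s hs
    rw [dslope_of_ne _ hs, slope_def_field, hVl, sub_zero, div_eq_mul_inv]
  have hline : ∀ y : ℝ, (ε + y * Complex.I : ℂ) ≠ l := fun y h => by
    have := congrArg Complex.re h
    simp at this
    exact hl.ne this
  have hsub : ∀ y : ℝ, (ε + y * Complex.I - l : ℂ)⁻¹ = -(((l - ε : ℝ) : ℂ) - y * Complex.I)⁻¹ := by
    intro y
    rw [← inv_neg]
    congr 1
    push_cast
    ring
  have hVi := integrable_cauchy hε hl hVd hVC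
  have hEd : DifferentiableOn ℂ (fun s : ℂ => (s + 1)⁻¹) {s : ℂ | 0 < s.re} :=
    DifferentiableOn.inv (by fun_prop) fun s hs => hs1 s hs
  have hEi := integrable_cauchy (C := 1) hε hl hEd (fun s _ => by rw [norm_inv, one_mul])
  have hQline : ∀ y : ℝ, dslope V l (ε + y * Complex.I)
      = -(V (ε + y * Complex.I) * (((l - ε : ℝ) : ℂ) - y * Complex.I)⁻¹) := by
    intro y
    rw [hQ _ (hline y), hsub, mul_neg]
  have hzero : ∫ y : ℝ, dslope V l (ε + y * Complex.I) = 0 := by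
    refine integral_vertical_eq_zero (C := 2 * C') (R₀ := 2 * l) hε hQd (fun s hs hsl => ?_) ?_
    · have hs0 : 0 < ‖s‖ := by linarith
      have hne : s ≠ l := by
        rintro rfl
        rw [Complex.norm_real, Real.norm_of_nonneg hl0.le] at hsl
        linarith
      have b1 : ‖s‖ / 2 ≤ ‖s - l‖ := by
        have := norm_sub_norm_le s l
        rw [Complex.norm_real, Real.norm_of_nonneg hl0.le] at this
        linarith
      have b2 : ‖s‖ ≤ ‖s + 1‖ := by
        refine abs_le_of_sq_le_sq' ?_ (norm_nonneg _) |>.2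
        rw [← Complex.normSq_eq_norm_sq, ← Complex.normSq_eq_norm_sq, Complex.normSq_apply,
          Complex.normSq_apply]
        simp
        nlinarith
      rw [hQ s hne, norm_mul, norm_inv]
      calc ‖V s‖ * ‖s - l‖⁻¹ ≤ (C' * ‖s + 1‖⁻¹) * ‖s - l‖⁻¹ := by
            gcongr
            exact hVC s hs
        _ ≤ (C' * ‖s‖⁻¹) * (‖s‖ / 2)⁻¹ := by gcongr
        _ = 2 * C' / ‖s‖ ^ 2 := by field_simp
    · simp_rw [hQline]
      exact hVi.neg
  simp_rw [hQline] at hzero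
  rw [integral_neg, neg_eq_zero] at hzero
  have hdecomp : ∀ y : ℝ, W (ε + y * Complex.I) * (((l - ε : ℝ) : ℂ) - y * Complex.I)⁻¹
      = V (ε + y * Complex.I) * (((l - ε : ℝ) : ℂ) - y * Complex.I)⁻¹ + W l * (l + 1) *
        ((ε + y * Complex.I + 1)⁻¹ * (((l - ε : ℝ) : ℂ) - y * Complex.I)⁻¹) := by
    intro y
    simp only [hV]
    ring
  simp_rw [hdecomp]
  rw [integral_add hVi (hEi.const_mul _), hzero, zero_add, integral_const_mul]
  have hE := integral_inv_mul_inv (r := 1 + ε) (q := l - ε) (by positivity) hle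
  have hE' : ∫ y : ℝ, (ε + y * Complex.I + 1 : ℂ)⁻¹ * (((l - ε : ℝ) : ℂ) - y * Complex.I)⁻¹
      = 2 * Real.pi / (l + 1) := by
    have e1 : ∀ y : ℝ, (ε + y * Complex.I + 1 : ℂ) = ((1 + ε : ℝ) : ℂ) + y * Complex.I := by
      intro y
      push_cast
      ring
    simp_rw [e1]
    rw [hE]
    push_cast
    congr 1
    ring
  rw [hE']
  field_simp

/-! ### A Carleson-type embedding from a local Sobolev inequality. -/

theorem norm_sq_le_integral {Φ Φ' : ℝ → ℂ} (hΦ : ∀ y, HasDerivAt Φ (Φ' y) y) (hc : Continuous Φ')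
    (y : ℝ) : ‖Φ y‖ ^ 2 ≤ 2 * ∫ v in y..(y + 1), (‖Φ v‖ ^ 2 + ‖Φ' v‖ ^ 2) := by
  have hcΦ : Continuous Φ := continuous_iff_continuousAt.2 fun y => (hΦ y).continuousAt
  -- The weight v - (y+1) vanishes at the right endpoint and equals -1 at the left, so the
  -- fundamental theorem of calculus isolates ‖Φ y‖².
  have hd : ∀ v ∈ Set.uIcc y (y + 1), HasDerivAt (fun v => (v - (y + 1)) * ‖Φ v‖ ^ 2)
      (1 * ‖Φ v‖ ^ 2 + (v - (y + 1)) * (2 * inner ℝ (Φ v) (Φ' v))) v := fun v _ =>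
    ((hasDerivAt_id v).sub_const (y + 1)).mul (hΦ v).norm_sq
  have hci : Continuous fun v => 1 * ‖Φ v‖ ^ 2 + (v - (y + 1)) * (2 * inner ℝ (Φ v) (Φ' v)) := by
    fun_prop
  have h := intervalIntegral.integral_eq_sub_of_hasDerivAt hd (hci.intervalIntegrable _ _)
  have e : (y + 1 - (y + 1)) * ‖Φ (y + 1)‖ ^ 2 - (y - (y + 1)) * ‖Φ y‖ ^ 2 = ‖Φ y‖ ^ 2 := by ring
  rw [e] at h
  rw [← h, ← intervalIntegral.integral_const_mul]
  refine intervalIntegral.integral_mono_on (by linarith) (hci.intervalIntegrable _ _)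
    ((by fun_prop : Continuous fun v => 2 * (‖Φ v‖ ^ 2 + ‖Φ' v‖ ^ 2)).intervalIntegrable _ _)
    fun v hv => ?_
  have h1 : |inner ℝ (Φ v) (Φ' v)| ≤ ‖Φ v‖ * ‖Φ' v‖ := abs_real_inner_le_norm _ _
  have h2 : |v - (y + 1)| ≤ 1 := abs_le.2 ⟨by linarith [hv.1], by linarith [hv.2]⟩
  have h3 : (v - (y + 1)) * inner ℝ (Φ v) (Φ' v) ≤ ‖Φ v‖ * ‖Φ' v‖ := by
    refine (le_abs_self _).trans ?_
    rw [abs_mul]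
    exact (mul_le_mul h2 h1 (abs_nonneg _) zero_le_one).trans (one_mul _).le
  nlinarith [sq_nonneg (‖Φ v‖ - ‖Φ' v‖), sq_nonneg ‖Φ' v‖]

/-- Insert the local Sobolev bound and swap integrals: v lies in [y, y+1] exactly when y lies in
[v-1, v], a unit interval on which `G` has mass at most `M`. -/
theorem lintegral_mul_norm_sq_le {G : ℝ → ℝ≥0∞} (hG : AEMeasurable G) {M : ℝ≥0∞}
    (hM : ∀ t : ℝ, ∫⁻ y in Set.Icc t (t + 1), G y ≤ M) {Φ Φ' : ℝ → ℂ}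
    (hΦ : ∀ y, HasDerivAt Φ (Φ' y) y) (hc : Continuous Φ') :
    ∫⁻ y, G y * ‖Φ y‖ₑ ^ 2 ≤ 2 * M * ∫⁻ v, (‖Φ v‖ₑ ^ 2 + ‖Φ' v‖ₑ ^ 2) := by
  have hcΦ : Continuous Φ := continuous_iff_continuousAt.2 fun y => (hΦ y).continuousAt
  set J : ℝ → ℝ≥0∞ := fun v => ‖Φ v‖ₑ ^ 2 + ‖Φ' v‖ₑ ^ 2 with hJ
  have hJm : Measurable J := by fun_prop
  have h1 : ∀ y, ‖Φ y‖ₑ ^ 2 ≤ 2 * ∫⁻ v in Set.Icc y (y + 1), J v := by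
    intro y
    have hcont : Continuous fun v => ‖Φ v‖ ^ 2 + ‖Φ' v‖ ^ 2 := by fun_prop
    have := norm_sq_le_integral hΦ hc y
    rw [intervalIntegral.integral_of_le (by linarith), ← integral_Icc_eq_integral_Ioc] at this
    rw [← ofReal_norm, ← ENNReal.ofReal_pow (norm_nonneg _)]
    refine (ENNReal.ofReal_le_ofReal this).trans ?_
    rw [ENNReal.ofReal_mul zero_le_two, ofReal_integral_eq_lintegral_ofReal
      (hcont.continuousOn.integrableOn_compact isCompact_Icc) (.of_forall fun v => by positivity)]
    simp only [hJ, ENNReal.ofReal_ofNat]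
    gcongr with v
    rw [ENNReal.ofReal_add (by positivity) (by positivity), ENNReal.ofReal_pow (norm_nonneg _),
      ENNReal.ofReal_pow (norm_nonneg _), ofReal_norm, ofReal_norm]
  have hset : MeasurableSet {z : ℝ × ℝ | z.1 ≤ z.2 ∧ z.2 ≤ z.1 + 1} :=
    (measurableSet_le measurable_fst measurable_snd).inter
      (measurableSet_le measurable_snd (measurable_fst.add_const 1))
  have h2 : ∀ y, 2 * ∫⁻ v in Set.Icc y (y + 1), J v
      = ∫⁻ v, 2 * (Set.Icc y (y + 1)).indicator J v := by
    intro y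
    rw [lintegral_const_mul' _ _ (by simp), lintegral_indicator measurableSet_Icc]
  calc ∫⁻ y, G y * ‖Φ y‖ₑ ^ 2
      ≤ ∫⁻ y, G y * ∫⁻ v, 2 * (Set.Icc y (y + 1)).indicator J v := by
        gcongr with y
        rw [← h2]
        exact h1 y
    _ = ∫⁻ y, ∫⁻ v, G y * (2 * (Set.Icc y (y + 1)).indicator J v) := by
        refine lintegral_congr fun y => (lintegral_const_mul _ ?_).symm
        exact (hJm.indicator measurableSet_Icc).const_mul 2
    _ = ∫⁻ v, ∫⁻ y, G y * (2 * (Set.Icc y (y + 1)).indicator J v) := by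
        refine lintegral_lintegral_swap ?_
        refine (hG.comp_fst).mul (AEMeasurable.const_mul ?_ 2)
        have : (fun z : ℝ × ℝ => (Set.Icc z.1 (z.1 + 1)).indicator J z.2)
            = {z : ℝ × ℝ | z.1 ≤ z.2 ∧ z.2 ≤ z.1 + 1}.indicator (fun z => J z.2) := by
          ext z
          by_cases h : z.1 ≤ z.2 ∧ z.2 ≤ z.1 + 1
          · simp [Set.indicator, h]
          · simp [Set.indicator, h]
        rw [this]
        exact ((hJm.comp measurable_snd).indicator hset).aemeasurable
    _ ≤ ∫⁻ v, 2 * M * J v := by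
        refine lintegral_mono fun v => ?_
        have : ∀ y, G y * (2 * (Set.Icc y (y + 1)).indicator J v)
            = (Set.Icc (v - 1) (v - 1 + 1)).indicator G y * (2 * J v) := by
          intro y
          have : v ∈ Set.Icc y (y + 1) ↔ y ∈ Set.Icc (v - 1) (v - 1 + 1) := by
            simp only [Set.mem_Icc]
            constructor <;> rintro ⟨h1, h2⟩ <;> constructor <;> linarith
          simp only [Set.indicator, this]
          split_ifs <;> simp
        simp_rw [this]
        rw [lintegral_mul_const'' _ (hG.indicator measurableSet_Icc),
          lintegral_indicator measurableSet_Icc, mul_comm 2 M, mul_assoc]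
        gcongr
        exact hM _
    _ = 2 * M * ∫⁻ v, J v := lintegral_const_mul _ hJm

theorem continuous_fourier {f : ℝ → ℂ} (hf : Integrable f) : Continuous (𝓕 f) :=
  VectorFourier.fourierIntegral_continuous Real.continuous_fourierChar continuous_inner hf

theorem lintegral_fourier_comp_sq {f : ℝ → ℂ} (h1 : Integrable f) (h2 : MemLp f 2) {k : ℝ}
    (hk : 0 < k) : ∫⁻ y, ‖𝓕 f (k * y)‖ₑ ^ 2 = ENNReal.ofReal k⁻¹ * ∫⁻ t, ‖f t‖ₑ ^ 2 := by
  rw [← lintegral_fourier_sq h1 h2]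
  exact lintegral_comp_mul_left hk
    (F := fun w => ‖𝓕 f w‖ₑ ^ 2) ((continuous_fourier h1).measurable.enorm.pow_const 2)

/-- A Carleson-type embedding on vertical lines inside the right half-plane. -/
theorem exists_lintegral_mul_mell_sq_le {a β : ℝ} (ha : 0 < a) (hβ : 0 < β) {G : ℝ → ℝ≥0∞}
    (hG : AEMeasurable G) {M : ℝ≥0∞} (hMt : M < ⊤)
    (hM : ∀ t : ℝ, ∫⁻ y in Set.Icc t (t + 1), G y ≤ M) :
    ∃ C < (⊤ : ℝ≥0∞), ∀ q : L2, ∫⁻ y : ℝ, G y * ‖mell q (β + (a * y : ℝ) * Complex.I)‖ₑ ^ 2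
      ≤ C * ‖q‖ₑ ^ 2 := by
  set k : ℝ := a / (2 * Real.pi) with hk
  have hk0 : 0 < k := by positivity
  set A : ℝ≥0∞ := ENNReal.ofReal k⁻¹ + ENNReal.ofReal k ^ 2 *
    (ENNReal.ofReal k⁻¹ * ENNReal.ofReal (2 * Real.pi / β) ^ 2) with hA
  refine ⟨2 * M * A, ?_, fun q => ?_⟩
  · refine ENNReal.mul_lt_top (ENNReal.mul_lt_top (by simp) hMt) (ENNReal.add_lt_top.2 ⟨by simp, ?_⟩)
    exact ENNReal.mul_lt_top (by simp) (ENNReal.mul_lt_top (by simp) (by simp))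
  · have hl := memLp_lift q
    set F : ℝ → ℂ := fun u => (Real.exp (-β * u) : ℂ) * lift q u with hF
    -- The transform of `F₁` is the derivative of that of `F`. Since β > 0, e^(-βu) absorbs the
    -- factor u, with u e^(-βu) ≤ 1/β; this is what controls the derivative term by ‖q‖.
    set F₁ : ℝ → ℂ := fun u => (-2 * Real.pi * Complex.I * u) • F u with hF₁
    have hFm : AEStronglyMeasurable F :=
      (by fun_prop : Continuous fun u : ℝ => (Real.exp (-β * u) : ℂ)).aestronglyMeasurable.mul hl.1
    have hF₁m : AEStronglyMeasurable F₁ :=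
      (by fun_prop : Continuous fun u : ℝ =>
        (-2 * Real.pi * Complex.I * u : ℂ)).aestronglyMeasurable.smul hFm
    have hFn : ∀ u, ‖F u‖ = Real.exp (-β * |u|) * ‖lift q u‖ := by
      intro u
      rcases le_or_gt u 0 with hu | hu
      · simp [hF, lift_of_nonpos q hu]
      · rw [hF, norm_mul, Complex.norm_real, Real.norm_of_nonneg (Real.exp_pos _).le, abs_of_pos hu]
    have hF₁n : ∀ u, ‖F₁ u‖ = 2 * Real.pi * |u| * ‖F u‖ := by
      intro u
      rw [hF₁, norm_smul]
      simp [abs_of_pos Real.pi_pos]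
    have hexp : ∀ c : ℝ, 0 < c → ∀ u : ℝ, |u| * Real.exp (-c * |u|) ≤ 1 / c := by
      intro c hc u
      rw [neg_mul, Real.exp_neg, ← div_eq_mul_inv, div_le_div_iff₀ (Real.exp_pos _) hc]
      linarith [Real.add_one_le_exp (c * |u|)]
    have hF1 : Integrable F := by
      refine ((memLp_exp_neg_mul_abs hβ).integrable_mul hl.norm).mono' hFm (.of_forall fun u => ?_)
      rw [hFn]
      rfl
    have hFle : ∀ u, ‖F u‖ ≤ ‖lift q u‖ := by
      intro u
      rw [hFn]
      refine mul_le_of_le_one_left (norm_nonneg _) (Real.exp_le_one_iff.2 ?_)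
      rw [neg_mul]
      simpa using by positivity
    have hF₁le : ∀ u, ‖F₁ u‖ ≤ 2 * Real.pi / β * ‖lift q u‖ := by
      intro u
      rw [hF₁n, hFn]
      calc 2 * Real.pi * |u| * (Real.exp (-β * |u|) * ‖lift q u‖)
          = 2 * Real.pi * (|u| * Real.exp (-β * |u|)) * ‖lift q u‖ := by ring
        _ ≤ 2 * Real.pi * (1 / β) * ‖lift q u‖ := by
            gcongr
            exact hexp β hβ u
        _ = _ := by ring
    have hF2 : MemLp F 2 := hl.of_le hFm (.of_forall hFle)
    have hF₁2 : MemLp F₁ 2 := hl.of_le_mul hF₁m (.of_forall hF₁le)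
    have hF₁1 : Integrable F₁ := by
      refine (((memLp_exp_neg_mul_abs (half_pos hβ)).integrable_mul hl.norm).const_mul
        (2 * Real.pi * (1 / (β / 2)))).mono' hF₁m (.of_forall fun u => ?_)
      rw [hF₁n, hFn]
      have e : Real.exp (-β * |u|) = Real.exp (-(β / 2) * |u|) * Real.exp (-(β / 2) * |u|) := by
        rw [← Real.exp_add]
        congr 1
        ring
      calc 2 * Real.pi * |u| * (Real.exp (-β * |u|) * ‖lift q u‖)
          = 2 * Real.pi * (|u| * Real.exp (-(β / 2) * |u|)) *
            (Real.exp (-(β / 2) * |u|) * ‖lift q u‖) := by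
            rw [e]
            ring
        _ ≤ 2 * Real.pi * (1 / (β / 2)) * (Real.exp (-(β / 2) * |u|) * ‖lift q u‖) := by
            gcongr
            exact hexp _ (half_pos hβ) u
    have hΦeq : ∀ y : ℝ, mell q (β + (a * y : ℝ) * Complex.I) = 𝓕 F (k * y) := by
      intro y
      rw [mell_eq_fourier, hk]
      exact congrArg (𝓕 F) (by ring)
    have hder : ∀ y, HasDerivAt (fun y : ℝ => 𝓕 F (k * y)) (k • 𝓕 F₁ (k * y)) y := by
      intro y
      have hid : Integrable (fun u : ℝ => u • F u) := by
        refine (hF₁1.norm.const_mul (2 * Real.pi)⁻¹).mono'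
          (continuous_id.aestronglyMeasurable.smul hFm) (.of_forall fun u => ?_)
        rw [hF₁n, norm_smul, Real.norm_eq_abs, mul_assoc, inv_mul_cancel_left₀ (by positivity)]
      have h1 := Real.hasDerivAt_fourier hF1 hid (k * y)
      have h2 : HasDerivAt (fun y : ℝ => k * y) k y := by
        simpa using (hasDerivAt_id y).const_mul k
      exact h1.scomp y h2
    have hmain := lintegral_mul_norm_sq_le hG hM hder
      (((continuous_fourier hF₁1).comp (by fun_prop : Continuous fun y : ℝ => k * y)).const_smul k)
    simp_rw [hΦeq]
    refine hmain.trans ?_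
    rw [mul_assoc (2 * M)]
    gcongr
    have hmF : Measurable fun v => ‖𝓕 F (k * v)‖ₑ ^ 2 :=
      (((continuous_fourier hF1).comp
        (by fun_prop : Continuous fun y : ℝ => k * y)).measurable.enorm).pow_const 2
    rw [lintegral_add_left hmF]
    have i1 : ∫⁻ v, ‖𝓕 F (k * v)‖ₑ ^ 2 ≤ ENNReal.ofReal k⁻¹ * ‖q‖ₑ ^ 2 := by
      rw [lintegral_fourier_comp_sq hF1 hF2 hk0, ← lintegral_lift_lp]
      gcongr with u
      exact enorm_le_iff_norm_le.2 (hFle u)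
    have i2 : ∫⁻ v, ‖k • 𝓕 F₁ (k * v)‖ₑ ^ 2 ≤ ENNReal.ofReal k ^ 2 *
        (ENNReal.ofReal k⁻¹ * ENNReal.ofReal (2 * Real.pi / β) ^ 2) * ‖q‖ₑ ^ 2 := by
      have e1 : ∀ v, ‖k • 𝓕 F₁ (k * v)‖ₑ ^ 2 = ENNReal.ofReal k ^ 2 * ‖𝓕 F₁ (k * v)‖ₑ ^ 2 := by
        intro v
        rw [enorm_smul, mul_pow, Real.enorm_of_nonneg hk0.le]
      simp_rw [e1]
      rw [lintegral_const_mul' _ _ (by simp), lintegral_fourier_comp_sq hF₁1 hF₁2 hk0,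
        ← lintegral_lift_lp, mul_assoc, mul_assoc]
      refine mul_le_mul_right (mul_le_mul_right ?_ _) _
      rw [← lintegral_const_mul' _ _ (by simp)]
      gcongr with u
      rw [← mul_pow]
      gcongr
      rw [← ofReal_norm, ← ofReal_norm, ← ENNReal.ofReal_mul (by positivity)]
      exact ENNReal.ofReal_le_ofReal (hF₁le u)
    rw [hA, add_mul]
    exact add_le_add i1 i2

/-! ### Boundary estimate of the sesquilinear form on polynomials. -/

/-- The Mellin transform of a linear combination of monomials, as a rational function. -/
def ratSum (α : ℕ →₀ ℂ) (s : ℂ) : ℂ := α.sum fun n z => z * (s + n + 1 / 2)⁻¹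

theorem add_natCast_add_half_ne_zero {s : ℂ} (hs : -1 / 2 < s.re) (n : ℕ) : s + n + 1 / 2 ≠ 0 :=
  fun h => by
    have := congrArg Complex.re h
    simp at this
    linarith [n.cast_nonneg (α := ℝ)]

theorem continuousAt_ratSum (α : ℕ →₀ ℂ) {s : ℂ} (hs : -1 / 2 < s.re) :
    ContinuousAt (ratSum α) s := by
  unfold ratSum Finsupp.sum
  refine tendsto_finsetSum _ fun n _ => Tendsto.const_mul _ (Tendsto.inv₀ ?_
    (add_natCast_add_half_ne_zero hs n))
  exact (by fun_prop : Continuous fun s : ℂ => s + n + 1 / 2).continuousAt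

theorem exists_norm_ratSum_le (α : ℕ →₀ ℂ) {a β : ℝ} (ha : 0 < a) (hβ : 0 < β) :
    ∃ C, ∀ s : ℂ, 0 ≤ s.re → ‖ratSum α (a * s + β)‖ ≤ C * ‖s + 1‖⁻¹ := by
  refine ⟨∑ n ∈ α.support, ‖α n‖ * (min a (β + n + 1 / 2))⁻¹, fun s hs => ?_⟩
  rw [ratSum, Finsupp.sum, Finset.sum_mul]
  refine norm_sum_le_of_le _ fun n _ => ?_
  rw [norm_mul, mul_assoc]
  gcongr
  have := norm_inv_affine_le ha (d := β + n + 1 / 2) (by positivity) hs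
  push_cast at this
  rwa [← add_assoc, ← add_assoc] at this

theorem bdry_polyMap_ae_eq (α : ℕ →₀ ℂ) :
    ∀ᵐ y : ℝ, bdry (polyMap α) y = ratSum α (y * Complex.I) := by
  filter_upwards [ae_tendsto_mell (polyMap α)] with y hy
  refine tendsto_nhds_unique hy ?_
  have h1 : Tendsto (fun x : ℝ => (x + y * Complex.I : ℂ)) (𝓝[>] 0) (𝓝 (y * Complex.I)) := by
    have := (by fun_prop : Continuous fun x : ℝ => (x + y * Complex.I : ℂ)).tendsto 0
    rw [Complex.ofReal_zero, zero_add] at this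
    exact this.mono_left nhdsWithin_le_nhds
  have h2 := (continuousAt_ratSum α (s := y * Complex.I) (by norm_num)).tendsto.comp h1
  refine h2.congr' ?_
  filter_upwards [self_mem_nhdsWithin] with x hx
  exact (mell_polyMap α (by simpa using hx)).symm

theorem lintegral_ratSum_sq (α : ℕ →₀ ℂ) :
    ∫⁻ y : ℝ, ‖ratSum α (y * Complex.I)‖ₑ ^ 2 = ENNReal.ofReal (2 * Real.pi) * ‖polyMap α‖ₑ ^ 2 := by
  rw [← lintegral_bdry_sq]
  refine lintegral_congr_ae ?_
  filter_upwards [bdry_polyMap_ae_eq α] with y hy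
  rw [hy]

/-- The kernel `Σ ᾱ_n / (n + 1/2 - ε - iy)`, conjugate to a shifted `ratSum`. -/
theorem conj_ratSum (α : ℕ →₀ ℂ) (ε y : ℝ) :
    starRingEnd ℂ (ratSum α (-ε + y * Complex.I)) = α.sum fun n z =>
      starRingEnd ℂ z * (((n + 1 / 2 - ε : ℝ) : ℂ) - y * Complex.I)⁻¹ := by
  rw [ratSum, Finsupp.sum, Finsupp.sum, map_sum]
  refine Finset.sum_congr rfl fun n _ => ?_
  rw [map_mul, map_inv₀]
  congr 2
  simp [map_ofNat]
  ring

theorem norm_ratSum_shift_le (α : ℕ →₀ ℂ) {ε : ℝ} (hε : ε ≤ 1 / 4) (y : ℝ) :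
    ‖ratSum α (-ε + y * Complex.I)‖ ≤ (∑ n ∈ α.support, ‖α n‖ * 4) * japanese y := by
  rw [ratSum, Finsupp.sum, Finset.sum_mul]
  refine norm_sum_le_of_le _ fun n _ => ?_
  rw [norm_mul, mul_assoc]
  gcongr
  have hn : (0 : ℝ) ≤ n := n.cast_nonneg
  have h1 := norm_inv_add_mul_I_le (d := n + 1 / 2 - ε) (by linarith) y
  have h2 : (-ε + y * Complex.I + n + 1 / 2 : ℂ) = ((n + 1 / 2 - ε : ℝ) : ℂ) + y * Complex.I := by
    push_cast
    ring
  rw [h2]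
  refine h1.trans (mul_le_mul_of_nonneg_right ?_ (japanese_nonneg y))
  -- As ε ≤ 1/4, each pole stays at distance n + 1/2 - ε ≥ 1/4 from the line, whence the constant 4.
  rw [inv_le_comm₀ (lt_min one_pos (by linarith)) (by norm_num)]
  exact le_min (by norm_num) (by linarith)

section Sufficiency

variable {h : ℂ → ℂ} {g : ℝ → ℂ} {a β : ℝ}

theorem continuous_line {F : ℂ → ℂ} (hF : DifferentiableOn ℂ F {s : ℂ | 0 < s.re}) {ε : ℝ}
    (hε : 0 < ε) : Continuous (fun y : ℝ => F (ε + y * Complex.I)) :=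
  hF.continuousOn.comp_continuous (by fun_prop) fun y => by simpa using hε

theorem IsBoundaryFunction.aemeasurable (hg : IsBoundaryFunction h g)
    (hh : DifferentiableOn ℂ h {s : ℂ | 0 < s.re}) : AEMeasurable g := by
  refine aemeasurable_of_tendsto_metrizable_ae atTop
    (f := fun (n : ℕ) (y : ℝ) => h (((1 / ((n : ℝ) + 1) : ℝ) : ℂ) + y * Complex.I))
    (fun n => (continuous_line hh (by positivity)).aemeasurable) ?_
  filter_upwards [hg] with y hy
  refine hy.comp (tendsto_nhdsWithin_iff.2 ⟨tendsto_one_div_add_atTop_nhds_zero_nat,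
    .of_forall fun n => ?_⟩)
  simp only [Set.mem_Ioi]
  positivity

/-- A bound for the pairing of a bounded function of the form `h₀ · (q ∘ φ)` with a linear
combination of reproducing kernels by boundary values. -/
theorem enorm_sum_le_lintegral_of_bounded (ha : 0 < a) (hβ : 0 < β) {h₀ : ℂ → ℂ} {E : ℝ}
    (hh₀ : DifferentiableOn ℂ h₀ {s : ℂ | 0 < s.re}) (hE : ∀ s : ℂ, 0 < s.re → ‖h₀ s‖ ≤ E)
    (hh : DifferentiableOn ℂ h {s : ℂ | 0 < s.re}) (hle : ∀ s : ℂ, 0 < s.re → ‖h₀ s‖ ≤ ‖h s‖)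
    (hg : IsBoundaryFunction h g) {Q : ℂ → ℂ} (hQ : DifferentiableOn ℂ Q {s : ℂ | 0 < s.re})
    {D : ℝ} (hD : ∀ s : ℂ, 0 < s.re → ‖Q (a * s + β)‖ ≤ D * ‖s + 1‖⁻¹) (α : ℕ →₀ ℂ) :
    ENNReal.ofReal (2 * Real.pi) * ‖α.sum fun n z => starRingEnd ℂ z *
      (h₀ (n + 1 / 2) * Q (a * (n + 1 / 2) + β))‖ₑ
      ≤ ∫⁻ y : ℝ, ‖g y‖ₑ * ‖Q (β + (a * y : ℝ) * Complex.I)‖ₑ * ‖ratSum α (y * Complex.I)‖ₑ := by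
  have hE0 : 0 ≤ E := (norm_nonneg _).trans (hE 1 (by simp))
  have hD0 : 0 ≤ D := by
    have h1 := (norm_nonneg _).trans (hD 1 (by simp))
    exact nonneg_of_mul_nonneg_left h1 (by norm_num)
  have hφ : ∀ s : ℂ, 0 < s.re → 0 < (a * s + β : ℂ).re := by
    intro s hs
    simp
    positivity
  have hQφ : DifferentiableOn ℂ (fun s => Q (a * s + β)) {s : ℂ | 0 < s.re} :=
    hQ.comp (by fun_prop) hφ
  set W : ℂ → ℂ := fun s => h₀ s * Q (a * s + β) with hW
  have hWd : DifferentiableOn ℂ W {s : ℂ | 0 < s.re} := hh₀.mul hQφ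
  have hWC : ∀ s : ℂ, 0 < s.re → ‖W s‖ ≤ (E * D) * ‖s + 1‖⁻¹ := by
    intro s hs
    rw [hW, norm_mul, mul_assoc]
    exact mul_le_mul (hE s hs) (hD s hs) (norm_nonneg _) hE0
  -- Cauchy's formula on Re s = ε at each point n + 1/2; the weighted Cauchy kernels add up to the
  -- conjugate of `ratSum` on the mirrored line Re s = -ε.
  have hsum : ∀ ε : ℝ, 0 < ε → ε < 1 / 4 → (2 * Real.pi : ℂ) * (α.sum fun n z => starRingEnd ℂ z *
      W (n + 1 / 2)) = ∫ y : ℝ, W (ε + y * Complex.I) *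
        starRingEnd ℂ (ratSum α (-ε + y * Complex.I)) := by
    intro ε hε hε4
    have hl : ∀ n : ℕ, ε < (n : ℝ) + 1 / 2 := fun n => by linarith [n.cast_nonneg (α := ℝ)]
    simp_rw [conj_ratSum, Finsupp.sum, Finset.mul_sum]
    rw [integral_finsetSum]
    · refine Finset.sum_congr rfl fun n _ => ?_
      have h1 := integral_cauchy hε (hl n) hWd hWC
      have h2 : W ((((n : ℝ) + 1 / 2 : ℝ)) : ℂ) = W (n + 1 / 2) := by
        congr 1
        push_cast
        ring
      rw [h2] at h1
      simp_rw [mul_left_comm _ (starRingEnd ℂ (α n))]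
      rw [integral_const_mul, h1]
    · intro n _
      have := (integrable_cauchy hε (hl n) hWd hWC).const_mul (starRingEnd ℂ (α n))
      refine this.congr (.of_forall fun y => ?_)
      simp only
      ring
  -- Replacing |h₀| by min(|h|, E) provides a dominating bound as ε → 0 and makes only the boundary
  -- values of `h` appear in the limit, so none are needed for h₀.
  set I : ℝ → ℝ → ℝ≥0∞ := fun ε y => min ‖h (ε + y * Complex.I)‖ₑ (ENNReal.ofReal E) *
    ‖Q (a * (ε + y * Complex.I) + β)‖ₑ * ‖ratSum α (-ε + y * Complex.I)‖ₑ with hI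
  have hle1 : ∀ ε : ℝ, 0 < ε → ε < 1 / 4 → ENNReal.ofReal (2 * Real.pi) *
      ‖α.sum fun n z => starRingEnd ℂ z * W (n + 1 / 2)‖ₑ ≤ ∫⁻ y, I ε y := by
    intro ε hε hε4
    have h1 : ENNReal.ofReal (2 * Real.pi) = ‖(2 * Real.pi : ℂ)‖ₑ := by
      rw [← ofReal_norm]
      congr 1
      simp [abs_of_pos Real.pi_pos]
    rw [h1, ← enorm_mul, hsum ε hε hε4]
    refine (enorm_integral_le_lintegral_enorm _).trans (lintegral_mono fun y => ?_)
    have hpos : 0 < (ε + y * Complex.I : ℂ).re := by simpa using hε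
    simp only [hI, hW]
    rw [enorm_mul, RCLike.enorm_conj, enorm_mul]
    gcongr
    refine le_min (enorm_le_iff_norm_le.2 (hle _ hpos)) ?_
    rw [← ofReal_norm]
    exact ENNReal.ofReal_le_ofReal (hE _ hpos)
  have hlim : Tendsto (fun ε => ∫⁻ y, I ε y) (𝓝[>] 0)
      (𝓝 (∫⁻ y : ℝ, min ‖g y‖ₑ (ENNReal.ofReal E) * ‖Q (β + (a * y : ℝ) * Complex.I)‖ₑ *
        ‖ratSum α (y * Complex.I)‖ₑ)) := by
    set S := ∑ n ∈ α.support, ‖α n‖ * 4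
    have hS0 : 0 ≤ S := Finset.sum_nonneg fun n _ => by positivity
    refine tendsto_lintegral_filter_of_dominated_convergence
      (fun y => ENNReal.ofReal (E * D * S * (1 + y ^ 2)⁻¹)) ?_ ?_ ?_ ?_
    · filter_upwards [Ioo_mem_nhdsGT (by norm_num : (0 : ℝ) < 1 / 4)] with ε hε
      have c1 := (continuous_line hh hε.1).measurable
      have c2 := (continuous_line hQφ hε.1).measurable
      have c3 : Continuous (fun y : ℝ => ratSum α (-ε + y * Complex.I)) := by
        refine continuous_iff_continuousAt.2 fun y => ?_
        refine ContinuousAt.comp (f := fun y : ℝ => (-ε + y * Complex.I : ℂ)) (continuousAt_ratSum α ?_)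
          (by fun_prop)
        simp
        linarith [hε.2]
      exact ((c1.enorm.min measurable_const).mul c2.enorm).mul c3.measurable.enorm
    · filter_upwards [Ioo_mem_nhdsGT (by norm_num : (0 : ℝ) < 1 / 4)] with ε hε
      refine .of_forall fun y => ?_
      have hpos : 0 < (ε + y * Complex.I : ℂ).re := by simpa using hε.1
      have hj := japanese_nonneg y
      rw [← japanese_mul_self]
      have e : E * D * S * (japanese y * japanese y) = E * (D * japanese y) * (S * japanese y) := by
        ring
      rw [e, ENNReal.ofReal_mul (by positivity), ENNReal.ofReal_mul hE0]
      simp only [hI]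
      gcongr
      · exact min_le_right _ _
      · rw [← ofReal_norm]
        refine ENNReal.ofReal_le_ofReal ((hD _ hpos).trans ?_)
        exact mul_le_mul_of_nonneg_left (inv_norm_le_japanese hε.1.le y) hD0
      · rw [← ofReal_norm]
        exact ENNReal.ofReal_le_ofReal (norm_ratSum_shift_le α hε.2.le y)
    · exact (integrable_inv_one_add_sq.const_mul (E * D * S)).lintegral_lt_top.ne
    · filter_upwards [hg] with y hy
      have hid : Tendsto (fun ε : ℝ => ε) (𝓝[>] 0) (𝓝 0) := nhdsWithin_le_nhds
      have t1 : Tendsto (fun ε : ℝ => min ‖h (ε + y * Complex.I)‖ₑ (ENNReal.ofReal E)) (𝓝[>] 0)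
          (𝓝 (min ‖g y‖ₑ (ENNReal.ofReal E))) :=
        ((continuous_enorm.tendsto _).comp hy).min tendsto_const_nhds
      have t2 : Tendsto (fun ε : ℝ => ‖Q (a * (ε + y * Complex.I) + β)‖ₑ) (𝓝[>] 0)
          (𝓝 ‖Q (β + (a * y : ℝ) * Complex.I)‖ₑ) := by
        refine (continuous_enorm.tendsto _).comp ?_
        have hβ' : (β + (a * y : ℝ) * Complex.I : ℂ) ∈ {s : ℂ | 0 < s.re} := by
          change 0 < (β + (a * y : ℝ) * Complex.I : ℂ).re
          rw [Complex.add_re, Complex.re_ofReal_mul]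
          simpa using hβ
        have hc := hQ.continuousOn.continuousAt (isOpen_rightHalfPlane.mem_nhds hβ')
        refine hc.tendsto.comp ?_
        have e : (β + (a * y : ℝ) * Complex.I : ℂ) = a * ((0 : ℝ) + y * Complex.I) + β := by
          push_cast
          ring
        rw [e]
        exact ((by fun_prop : Continuous fun ε : ℝ =>
          (a * (ε + y * Complex.I) + β : ℂ)).tendsto 0).comp hid
      have t3 : Tendsto (fun ε : ℝ => ‖ratSum α (-ε + y * Complex.I)‖ₑ) (𝓝[>] 0)
          (𝓝 ‖ratSum α (y * Complex.I)‖ₑ) := by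
        refine (continuous_enorm.tendsto _).comp ?_
        refine (continuousAt_ratSum α (s := y * Complex.I) (by norm_num)).tendsto.comp ?_
        have := ((by fun_prop : Continuous fun ε : ℝ => (-ε + y * Complex.I : ℂ)).tendsto 0).comp hid
        simpa [Function.comp_def] using this
      have f1 : min ‖g y‖ₑ (ENNReal.ofReal E) ≠ ⊤ :=
        ne_top_of_le_ne_top enorm_ne_top (min_le_left _ _)
      exact ENNReal.Tendsto.mul (ENNReal.Tendsto.mul t1 (.inr enorm_ne_top) t2 (.inr f1))
        (.inr enorm_ne_top) t3 (.inr (ENNReal.mul_ne_top f1 enorm_ne_top))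
  have hfin := ge_of_tendsto hlim (by
    filter_upwards [Ioo_mem_nhdsGT (by norm_num : (0 : ℝ) < 1 / 4)] with ε hε
    exact hle1 ε hε.1 hε.2)
  refine hfin.trans (lintegral_mono fun y => ?_)
  gcongr
  exact min_le_left _ _

/-- Apply the bounded case to h · e^(-G_N). The right-hand side does not depend on N, and on the
left finitely many values converge as G_N → 0. Here the Smirnov condition, rather than mere
holomorphy, is what passes from boundary values to the interior. -/
theorem enorm_sum_le_lintegral (ha : 0 < a) (hβ : 0 < β) (hh : IsSmirnov h)
    (hg : IsBoundaryFunction h g) {Q : ℂ → ℂ} (hQ : DifferentiableOn ℂ Q {s : ℂ | 0 < s.re})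
    {D : ℝ} (hD : ∀ s : ℂ, 0 < s.re → ‖Q (a * s + β)‖ ≤ D * ‖s + 1‖⁻¹) (α : ℕ →₀ ℂ) :
    ENNReal.ofReal (2 * Real.pi) * ‖α.sum fun n z => starRingEnd ℂ z *
      (h (n + 1 / 2) * Q (a * (n + 1 / 2) + β))‖ₑ
      ≤ ∫⁻ y : ℝ, ‖g y‖ₑ * ‖Q (β + (a * y : ℝ) * Complex.I)‖ₑ * ‖ratSum α (y * Complex.I)‖ₑ := by
  obtain ⟨G, hGd, hGre, hGb, hG0⟩ := hh.exists_outer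
  have hN := fun N => enorm_sum_le_lintegral_of_bounded ha hβ (h₀ := fun s => h s * Complex.exp (-G N s))
    (hh.1.mul (hGd N).neg.cexp) (hGb N) hh.1 (fun s hs => by
      rw [norm_mul, Complex.norm_exp]
      refine mul_le_of_le_one_right (norm_nonneg _) (Real.exp_le_one_iff.2 ?_)
      simpa using hGre N s hs) hg hQ hD α
  have hpos : ∀ n : ℕ, 0 < ((n : ℂ) + 1 / 2).re := fun n => by
    simp
    positivity
  have hlim : Tendsto (fun N => α.sum fun n z => starRingEnd ℂ z *
      (h (n + 1 / 2) * Complex.exp (-G N (n + 1 / 2)) * Q (a * (n + 1 / 2) + β))) atTop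
      (𝓝 (α.sum fun n z => starRingEnd ℂ z * (h (n + 1 / 2) * Q (a * (n + 1 / 2) + β)))) := by
    refine tendsto_finsetSum _ fun n _ => Tendsto.const_mul _ (Tendsto.mul_const _ ?_)
    have := ((Complex.continuous_exp.tendsto _).comp (hG0 _ (hpos n)).neg).const_mul (h (n + 1 / 2))
    simpa using this
  refine le_of_tendsto' (ENNReal.Tendsto.const_mul ((continuous_enorm.tendsto _).comp hlim)
    (.inr ENNReal.ofReal_ne_top)) hN

theorem lintegral_mul_le_sqrt {f k : ℝ → ℝ≥0∞} (hf : AEMeasurable f) (hk : AEMeasurable k) :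
    ∫⁻ y, f y * k y ≤ (∫⁻ y, f y ^ 2) ^ (1 / 2 : ℝ) * (∫⁻ y, k y ^ 2) ^ (1 / 2 : ℝ) := by
  have := ENNReal.lintegral_mul_le_Lp_mul_Lq volume Real.HolderConjugate.two_two hf hk
  simpa using this

/-- The Mellin-side form of boundedness: if `h` is uniformly locally square-integrable, then the
weighted composition form is bounded on linear combinations of monomials. -/
theorem exists_norm_sum_le (ha : 0 < a) (hβ : 0 < β) (hh : IsSmirnov h)
    (hu : UniformlyLocallyL2 h) : ∃ K : ℝ, ∀ α γ : ℕ →₀ ℂ,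
      ‖α.sum fun n z => starRingEnd ℂ z * (h (n + 1 / 2) * mell (polyMap γ) (a * (n + 1 / 2) + β))‖
        ≤ K * ‖polyMap γ‖ * ‖polyMap α‖ := by
  obtain ⟨g, hg, hM⟩ := hu
  have hgm := hg.aemeasurable hh.1
  -- The embedding with weight |h(iy)|² controls h · (F ∘ φ) in L² of the axis; Cauchy–Schwarz
  -- against `ratSum α` then gives the bilinear bound.
  obtain ⟨C, hC, hCq⟩ := exists_lintegral_mul_mell_sq_le ha hβ (hgm.enorm.pow_const 2) hM
    (fun t => le_iSup (fun t : ℝ => ∫⁻ y in Set.Icc t (t + 1), ‖g y‖ₑ ^ 2) t)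
  set K : ℝ≥0∞ := C ^ (1 / 2 : ℝ) * ENNReal.ofReal (2 * Real.pi) ^ (1 / 2 : ℝ) with hK
  have hKt : K ≠ ⊤ := ENNReal.mul_ne_top (ENNReal.rpow_ne_top_of_nonneg (by norm_num) hC.ne)
    (ENNReal.rpow_ne_top_of_nonneg (by norm_num) ENNReal.ofReal_ne_top)
  refine ⟨K.toReal, fun α γ => ?_⟩
  obtain ⟨D, hD⟩ := exists_norm_ratSum_le γ ha hβ
  have hD' : ∀ s : ℂ, 0 < s.re → ‖mell (polyMap γ) (a * s + β)‖ ≤ D * ‖s + 1‖⁻¹ := by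
    intro s hs
    rw [mell_polyMap γ (by simp; positivity)]
    exact hD s hs.le
  have h1 := enorm_sum_le_lintegral ha hβ hh hg (differentiableOn_mell (polyMap γ)) hD' α
  have hmQ : Continuous fun y : ℝ => mell (polyMap γ) (β + (a * y : ℝ) * Complex.I) := by
    have := (continuous_line (differentiableOn_mell (polyMap γ)) hβ).comp
      (by fun_prop : Continuous fun y : ℝ => a * y)
    exact this
  have hmR : Continuous fun y : ℝ => ratSum α (y * Complex.I) := by
    refine continuous_iff_continuousAt.2 fun y => ?_
    exact ContinuousAt.comp (f := fun y : ℝ => (y * Complex.I : ℂ))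
      (continuousAt_ratSum α (by norm_num)) (by fun_prop)
  have hsq : ∀ x : ℝ≥0∞, (x ^ 2) ^ (1 / 2 : ℝ) = x := fun x => by
    rw [← ENNReal.rpow_natCast, ← ENNReal.rpow_mul]
    norm_num
  have h2 : ∫⁻ y : ℝ, ‖g y‖ₑ * ‖mell (polyMap γ) (β + (a * y : ℝ) * Complex.I)‖ₑ *
      ‖ratSum α (y * Complex.I)‖ₑ ≤ K * ‖polyMap γ‖ₑ * ‖polyMap α‖ₑ := by
    refine (lintegral_mul_le_sqrt (hgm.enorm.mul hmQ.measurable.enorm.aemeasurable)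
      hmR.measurable.enorm.aemeasurable).trans ?_
    simp_rw [Pi.mul_apply, mul_pow]
    rw [lintegral_ratSum_sq]
    calc _ ≤ (C * ‖polyMap γ‖ₑ ^ 2) ^ (1 / 2 : ℝ) *
          (ENNReal.ofReal (2 * Real.pi) * ‖polyMap α‖ₑ ^ 2) ^ (1 / 2 : ℝ) := by
          gcongr
          exact hCq (polyMap γ)
      _ = K * ‖polyMap γ‖ₑ * ‖polyMap α‖ₑ := by
          rw [ENNReal.mul_rpow_of_nonneg _ _ (by norm_num),
            ENNReal.mul_rpow_of_nonneg _ _ (by norm_num), hsq, hsq, hK]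
          ring
  have h3 : (1 : ℝ≥0∞) ≤ ENNReal.ofReal (2 * Real.pi) := by
    rw [ENNReal.one_le_ofReal]
    linarith [Real.pi_gt_three]
  have h4 := (le_mul_of_one_le_left zero_le h3).trans (h1.trans h2)
  have h5 := ENNReal.toReal_mono (ENNReal.mul_ne_top (ENNReal.mul_ne_top hKt enorm_ne_top)
    enorm_ne_top) h4
  simpa [ENNReal.toReal_mul, toReal_enorm] using h5

end Sufficiency

/-! ### Extension of the operator by density. -/

/-- The operator on polynomials is defined on coefficients as `A`. Its pairing with q is the form
already bounded for polynomial q, and both sides of the bound are continuous in q, so density of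
polynomials gives it for all q. -/
theorem UniformlyLocallyL2.isBounded {a b : ℝ} {c p : ℕ → ℂ} {hp : ∀ n, -1 / 2 < (p n).re}
    (ha : 0 < a) (hb : 0 < b + (1 - a) / 2) (hpn : ∀ n : ℕ, p n = a * n + b) {h : ℂ → ℂ}
    (hh : IsAssociated c h) (hu : UniformlyLocallyL2 h) : IsBounded c p hp := by
  obtain ⟨K, hK⟩ := exists_norm_sum_le ha hb hh.smirnov hu
  set A : (ℕ →₀ ℂ) →ₗ[ℂ] L2 :=
    Finsupp.linearCombination ℂ (fun n : ℕ => c n • monomial (p n) (hp n)) with hA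
  have hinner : ∀ (α : ℕ →₀ ℂ) (q : L2), inner ℂ (A α) q = α.sum fun n z =>
      starRingEnd ℂ z * (h (n + 1 / 2) * mell q (a * (n + 1 / 2) + (b + (1 - a) / 2 : ℝ))) := by
    intro α q
    rw [hA, Finsupp.linearCombination_apply, Finsupp.sum, sum_inner]
    refine Finset.sum_congr rfl fun n _ => ?_
    rw [inner_smul_left, inner_smul_left, inner_monomial]
    dsimp only
    rw [hh.interp]
    congr 3
    rw [hpn]
    simp
    ring
  have hle : ∀ α, ‖A α‖ ≤ |K| * ‖polyMap α‖ := by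
    intro α
    have h1 : ∀ q : L2, ‖(inner ℂ (A α) q : ℂ)‖ ≤ |K| * ‖q‖ * ‖polyMap α‖ := by
      intro q
      refine denseRange_polyMap.induction_on q (isClosed_le (by fun_prop) (by fun_prop)) fun γ => ?_
      rw [hinner]
      refine (hK α γ).trans ?_
      gcongr
      exact le_abs_self K
    -- Testing with q = A α turns the bound on the form into ‖A α‖² ≤ |K| ‖A α‖ ‖polyMap α‖, the
    -- estimate needed to extend from the dense range.
    have h2 := h1 (A α)
    rw [inner_self_eq_norm_sq_to_K, norm_pow, RCLike.norm_ofReal, abs_of_nonneg (norm_nonneg _)] at h2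
    rcases (norm_nonneg (A α)).eq_or_lt with h0 | h0
    · rw [← h0]
      positivity
    · refine le_of_mul_le_mul_right ?_ h0
      nlinarith
  refine ⟨A.extendOfNorm polyMap, fun n => ?_⟩
  have h3 := LinearMap.extendOfNorm_eq denseRange_polyMap ⟨|K|, hle⟩ (Finsupp.single n 1)
  simpa [polyMap, hA] using h3

end MonomialOp

end

theorem mainTheorem3 (a b : ℝ) (ha : 0 < a) (hb : 0 < b + (1 - a) / 2)
    (c p : ℕ → ℂ) (hp : ∀ n, -1 / 2 < (p n).re) (hpn : ∀ n : ℕ, p n = a * n + b) :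
    (∀ h₁ h₂ : ℂ → ℂ, MonomialOp.IsAssociated c h₁ → MonomialOp.IsAssociated c h₂ →
        Set.EqOn h₁ h₂ {s : ℂ | 0 < s.re}) ∧
      (MonomialOp.IsBounded c p hp → ∃ h : ℂ → ℂ, MonomialOp.IsAssociated c h) ∧
      (∀ h : ℂ → ℂ, MonomialOp.IsAssociated c h →
        (MonomialOp.IsBounded c p hp ↔ MonomialOp.UniformlyLocallyL2 h)) := by
  exact ⟨fun h₁ h₂ H₁ H₂ => H₁.eqOn H₂, fun hT => hT.exists_isAssociated hpn,
    fun h hh => ⟨fun hT => hT.uniformlyLocallyL2 ha hb hpn hh, fun hu => hu.isBounded ha hb hpn hh⟩⟩
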